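/- Let $m>0$ and $\omega\in(-m,m)$. Let $\mathcal D=-i(\sigma_1\partial_1+\sigma_2\partial_2)$ be the massless Dirac operator on $\mathbb R^2$, where $\sigma_1=\begin{pmatrix}0&1\\1&0\end{pmatrix}$, $\sigma_2=\begin{pmatrix}0&-i\\i&0\end{pmatrix}$ and $\sigma_3=\begin{pmatrix}1&0\\0&-1\end{pmatrix}$ are the Pauli matrices. Let $\psi\in L^4(\mathbb R^2,\mathbb C^2)$ be a distributional solution of $$(\mathcal D+m\sigma_3-\omega)\psi=|\psi|^2\psi\qquad\text{on }\mathbb R^2,$$ that is, $$\int_{\mathbb R^2}\langle\psi,(\mathcal D+m\sigma_3-\omega)\chi\rangle\,dx=\int_{\mathbb R^2}|\psi|^2\langle\psi,\chi\rangle\,dx\qquad\text{for all }\chi\in C_c^\infty(\mathbb R^2,\mathbb C^2),$$ where $\langle\cdot,\cdot\rangle$ is the Hermitian inner product of $\mathbb C^2$. Then $\psi$ is smooth, i.e. it agrees almost everywhere with a function in $C^\infty(\mathbb R^2,\mathbb C^2)$. -/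

import Mathlib

open MeasureTheory

/-- The plane `ℝ²` with its Euclidean norm and Lebesgue measure. -/
abbrev Plane : Type := EuclideanSpace ℝ (Fin 2)

/-- The space `ℂ²` of spinors with its Hermitian norm. -/
abbrev Spinor : Type := EuclideanSpace ℂ (Fin 2)

/-- The Pauli matrix `σ₁`. -/
def pauli1 : Matrix (Fin 2) (Fin 2) ℂ := !![0, 1; 1, 0]

/-- The Pauli matrix `σ₂`. -/
def pauli2 : Matrix (Fin 2) (Fin 2) ℂ := !![0, -Complex.I; Complex.I, 0]

/-- The Pauli matrix `σ₃`. -/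
def pauli3 : Matrix (Fin 2) (Fin 2) ℂ := !![1, 0; 0, -1]

/-- The (real) partial derivative `∂ⱼ χ` at `x` of a spinor field on the plane. -/
noncomputable def partialDeriv (j : Fin 2) (χ : Plane → Spinor) (x : Plane) : Spinor :=
  fderiv ℝ χ x (EuclideanSpace.single j (1 : ℝ))

/-- The massless Dirac operator `𝒟 = -i (σ₁ ∂₁ + σ₂ ∂₂)`, applied classically to a
differentiable spinor field. -/
noncomputable def diracOp (χ : Plane → Spinor) (x : Plane) : Spinor :=
  (-Complex.I) • (Matrix.toEuclideanLin pauli1 (partialDeriv 0 χ x) +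
    Matrix.toEuclideanLin pauli2 (partialDeriv 1 χ x))

/-- The operator `𝒟 + m σ₃ - ω`, applied classically to a differentiable spinor field. -/
noncomputable def massiveDiracOp (m ω : ℝ) (χ : Plane → Spinor) (x : Plane) : Spinor :=
  diracOp χ x + (m : ℂ) • Matrix.toEuclideanLin pauli3 (χ x) - (ω : ℂ) • χ x

/-- The field `ψ` solves `(𝒟 + m σ₃ - ω) ψ = |ψ|² ψ` on the plane in the sense of distributions:
the equation is tested against every `χ ∈ C_c^∞(ℝ², ℂ²)`, with the (formally self-adjoint)
operator moved to `χ`. This is meant for `ψ` such that `ψ` and `|ψ|² ψ` are locally integrable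
(for instance `ψ ∈ L⁴`), so that all the integrals below converge. -/
def IsDistributionalSolution (m ω : ℝ) (ψ : Plane → Spinor) : Prop :=
  ∀ χ : Plane → Spinor, ContDiff ℝ (⊤ : ℕ∞) χ → HasCompactSupport χ →
    ∫ x, inner ℂ (massiveDiracOp m ω χ x) (ψ x) = ∫ x, inner ℂ (χ x) ((‖ψ x‖ ^ 2) • ψ x)

/-! Identify the plane with `ℂ` and put `v₀ = ψ₁`, `v₁ = conj ψ₂`. One row of the Dirac operator
acts on `ψ₁` by `∂₁ + i∂₂` and the other on `ψ₂` by `∂₁ - i∂₂`; conjugating `ψ₂` turns both rows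
into equations for the same operator `dbar = ∂₁ + i∂₂`, namely `dbar vⱼ = αⱼ (|v|² + βⱼ) conj vⱼ₊₁`
with `|αⱼ| = 1`. The constants `βⱼ`, which carry the mass and the frequency, play only a lower-order
role.

The exponent 4 is critical: the cubic term is in `L^{4/3}`, and the Cauchy transform, dominated by
the Riesz potential of order one, maps `L^{4/3}` only back to `L⁴`. The gain comes from smallness.
After a cutoff `η` near a point, `|ηv|` is bounded by a good term plus the potential of `W |ηv|`,
where `W = |v|²` has small `L²` norm on a small ball. By Hardy–Littlewood–Sobolev
(`exists_lintegral_rieszOp_pow_le`) and Hölder, `f ↦ rieszOp (W f)` is then a contraction on both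
`L⁴` and `L⁸`. Since the good term is in `L⁸`, so is `ηv` (`exists_smallness_rieszOp`). Now the
cubic term is locally in `L^{8/3}` with `8/3 > 2`, and its potential is bounded
(`exists_ae_norm_cutoff_mul_le`).

From boundedness to smoothness the argument is on the Fourier side, where `2πiξ û = Ĝ` for a
localised equation `dbar u = G`. A bounded `G` of compact support makes `u` Lipschitz in `L²`, that
is `H¹` (`WeakDbar.lipschitzL2`). Bounded `H¹` functions form an algebra, so `G` is in `H¹` too,
whence `|ξ|² û` is in `L²` and `û` is integrable (`WeakDbar.wienerClass_zero`). The weighted Wiener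
classes are algebras (`conjAlgebra_wienerClass`) and each use of the equation gains one power of the
weight (`WeakDbar.wienerClass_succ`). Hence `û` has all its moments and `u` is smooth. -/

open scoped ENNReal ComplexConjugate FourierTransform Convolution

/-! ### Radial integrals of powers of the kernel `1/|z|`. -/

/-- Integration of radial functions in the complex plane. -/
theorem lintegral_complex_radial {g : ℝ → ℝ≥0∞} (hg : Measurable g) :
    ∫⁻ z : ℂ, g ‖z‖ = ENNReal.ofReal (2 * Real.pi) *
      ∫⁻ r in Set.Ioi (0 : ℝ), ENNReal.ofReal r * g r := by
  rw [← Complex.lintegral_comp_polarCoord_symm, polarCoord_target, Measure.volume_eq_prod,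
    setLIntegral_prod]
  · have : ∀ r ∈ Set.Ioi (0 : ℝ), ∫⁻ θ in Set.Ioo (-Real.pi) Real.pi,
        ENNReal.ofReal (r, θ).1 • g ‖Complex.polarCoord.symm (r, θ)‖ =
        ENNReal.ofReal (2 * Real.pi) * (ENNReal.ofReal r * g r) := by
      intro r hr
      simp only [Complex.norm_polarCoord_symm, abs_of_pos (Set.mem_Ioi.1 hr), smul_eq_mul,
        lintegral_const, Measure.restrict_apply MeasurableSet.univ, Set.univ_inter,
        Real.volume_Ioo]
      rw [mul_comm]
      congr 2
      ring
    rw [setLIntegral_congr_fun measurableSet_Ioi this, lintegral_const_mul]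
    exact (ENNReal.measurable_ofReal.mul hg)
  · simp only [Complex.norm_polarCoord_symm]
    apply Measurable.aemeasurable
    fun_prop

theorem lintegral_enorm_inv_ball (R : ℝ) :
    ∫⁻ z : ℂ, (if ‖z‖ ≤ R then ‖z‖ₑ⁻¹ else 0) = ENNReal.ofReal (2 * Real.pi * R) := by
  have h := lintegral_complex_radial (g := fun r => if r ≤ R then (ENNReal.ofReal r)⁻¹ else 0)
    (Measurable.ite measurableSet_Iic (by fun_prop) measurable_const)
  simp only [ofReal_norm] at h
  rw [h, ENNReal.ofReal_mul (p := 2 * Real.pi) (by positivity)]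
  congr 1
  have : ∀ r ∈ Set.Ioi (0 : ℝ), ENNReal.ofReal r * (if r ≤ R then (ENNReal.ofReal r)⁻¹ else 0)
      = (Set.Iic R).indicator 1 r := by
    intro r hr
    by_cases h : r ≤ R
    · simp [h, ENNReal.mul_inv_cancel, Set.mem_Ioi.1 hr]
    · simp [h]
  rw [setLIntegral_congr_fun measurableSet_Ioi this, lintegral_indicator_one measurableSet_Iic,
    Measure.restrict_apply measurableSet_Iic]
  simp [Set.Iic_inter_Ioi]

theorem lintegral_enorm_inv_rpow_compl_ball {q R : ℝ} (hq : 2 < q) (hR : 0 < R) :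
    ∫⁻ z : ℂ, (if R < ‖z‖ then (‖z‖ₑ⁻¹) ^ q else 0) =
      ENNReal.ofReal (2 * Real.pi * (R ^ (2 - q) / (q - 2))) := by
  have h := lintegral_complex_radial
    (g := fun r => if R < r then ((ENNReal.ofReal r)⁻¹) ^ q else 0)
    (Measurable.ite measurableSet_Ioi (by fun_prop) measurable_const)
  simp only [ofReal_norm] at h
  rw [h, ENNReal.ofReal_mul (p := 2 * Real.pi) (by positivity)]
  congr 1
  have : ∀ r ∈ Set.Ioi (0 : ℝ), ENNReal.ofReal r *
      (if R < r then ((ENNReal.ofReal r)⁻¹) ^ q else 0)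
      = (Set.Ioi R).indicator (fun r => ENNReal.ofReal (r ^ (1 - q))) r := by
    intro r hr
    have hr : 0 < r := hr
    by_cases h : R < r
    · simp only [h, if_true, Set.mem_Ioi, Set.indicator_of_mem]
      rw [← ENNReal.ofReal_inv_of_pos hr, ENNReal.ofReal_rpow_of_pos (by positivity),
        ← ENNReal.ofReal_mul hr.le, Real.rpow_sub hr, Real.rpow_one, Real.inv_rpow hr.le]
      rfl
    · simp [h]
  rw [setLIntegral_congr_fun measurableSet_Ioi this, setLIntegral_indicator measurableSet_Ioi,
    Set.Ioi_inter_Ioi, sup_eq_left.2 hR.le, ← ofReal_integral_eq_lintegral_ofReal,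
    integral_Ioi_rpow_of_lt (by linarith) hR]
  · congr 1
    rw [show 1 - q + 1 = 2 - q by ring, ← neg_sub q 2, neg_div_neg_eq]
  · exact integrableOn_Ioi_rpow_of_lt (by linarith) hR
  · filter_upwards [ae_restrict_mem measurableSet_Ioi] with r hr
    have : 0 < r := hR.trans hr
    positivity

/-! ### The Riesz potential of order one and the Hardy–Littlewood–Sobolev inequality. -/

/-- The Riesz potential of order one in the plane (without normalising constant). -/
noncomputable def rieszOp (f : ℂ → ℝ≥0∞) (w : ℂ) : ℝ≥0∞ := ∫⁻ z, f z * ‖w - z‖ₑ⁻¹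

theorem measurable_rieszOp {f : ℂ → ℝ≥0∞} (hf : Measurable f) : Measurable (rieszOp f) := by
  unfold rieszOp
  apply Measurable.lintegral_prod_right' (f := fun p : ℂ × ℂ => f p.2 * ‖p.1 - p.2‖ₑ⁻¹)
  fun_prop

theorem rieszOp_mono {f g : ℂ → ℝ≥0∞} (h : ∀ᵐ z, f z ≤ g z) (w : ℂ) :
    rieszOp f w ≤ rieszOp g w :=
  lintegral_mono_ae (h.mono fun z hz => by gcongr)

theorem rieszOp_add {f g : ℂ → ℝ≥0∞} (hf : Measurable f) (w : ℂ) :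
    rieszOp (fun z => f z + g z) w = rieszOp f w + rieszOp g w := by
  simp only [rieszOp, add_mul]
  exact lintegral_add_left (by fun_prop) _

theorem rieszOp_const_mul {f : ℂ → ℝ≥0∞} (hf : Measurable f) (c : ℝ≥0∞) (w : ℂ) :
    rieszOp (fun z => c * f z) w = c * rieszOp f w := by
  simp only [rieszOp, mul_assoc]
  exact lintegral_const_mul _ (by fun_prop)

/-- The layer-cake identity, with `h = ∞` allowed because a potential may be infinite. It serves
twice below: to expand a power of the potential over levels `s`, and to carry out the `s`-integral
at the end. -/
theorem lintegral_Ioi_ofReal_pow_indicator (k : ℕ) (h : ℝ≥0∞) :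
    ∫⁻ s in Set.Ioi (0 : ℝ), (if ENNReal.ofReal s < h then ENNReal.ofReal s ^ k else 0) =
      h ^ (k + 1) / (k + 1 : ℕ) := by
  have key : ∀ a : ℝ, 0 ≤ a → ∫⁻ s in Set.Ioi (0 : ℝ),
      (if s < a then ENNReal.ofReal s ^ k else 0) = ENNReal.ofReal a ^ (k + 1) / (k + 1 : ℕ) := by
    intro a ha
    have : ∀ s ∈ Set.Ioi (0 : ℝ), (if s < a then ENNReal.ofReal s ^ k else 0) =
        (Set.Iio a).indicator (fun s => ENNReal.ofReal (s ^ k)) s := by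
      intro s hs
      by_cases h : s < a <;> simp [h, ENNReal.ofReal_pow (Set.mem_Ioi.1 hs).le]
    rw [setLIntegral_congr_fun measurableSet_Ioi this, setLIntegral_indicator measurableSet_Iio,
      Set.inter_comm, Set.Ioi_inter_Iio, restrict_Ioo_eq_restrict_Ioc,
      ← ofReal_integral_eq_lintegral_ofReal, ← intervalIntegral.integral_of_le ha, integral_pow]
    · rw [← ENNReal.ofReal_pow ha, ← ENNReal.ofReal_natCast,
        ← ENNReal.ofReal_div_of_pos (by positivity)]
      simp
    · exact (intervalIntegral.intervalIntegrable_pow k).1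
    · filter_upwards [ae_restrict_mem measurableSet_Ioc] with s hs
      have := hs.1
      positivity
  by_cases hh : h = ∞
  · rw [hh, ENNReal.top_pow (by simp), ENNReal.top_div_of_ne_top (by simp)]
    refine ENNReal.eq_top_of_forall_nnreal_le fun r => ?_
    have h1 := key ((r : ℝ) * (k + 1) + (k + 1)) (by positivity)
    refine le_trans (b := ENNReal.ofReal ((r : ℝ) * (k + 1) + (k + 1)) ^ (k + 1) / (k + 1 : ℕ))
      ?_ ?_
    · rw [ENNReal.le_div_iff_mul_le (by simp) (by simp), ← ENNReal.ofReal_coe_nnreal,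
        ← ENNReal.ofReal_natCast, ← ENNReal.ofReal_mul (by positivity),
        ← ENNReal.ofReal_pow (by positivity)]
      apply ENNReal.ofReal_le_ofReal
      have h2 : (1 : ℝ) ≤ (r : ℝ) * (k + 1) + (k + 1) := by
        have : (0 : ℝ) ≤ (r : ℝ) * (k + 1) := by positivity
        have : (0 : ℝ) ≤ k := by positivity
        linarith
      calc (r : ℝ) * ((k + 1 : ℕ) : ℝ) ≤ (r : ℝ) * (k + 1) + (k + 1) := by
            push_cast; linarith [(by positivity : (0 : ℝ) ≤ k)]
        _ ≤ _ := le_self_pow₀ h2 (by simp)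
    · rw [← h1]
      exact lintegral_mono fun s => by split_ifs <;> simp_all
  · lift h to NNReal using hh
    have h1 := key h h.2
    rw [ENNReal.ofReal_coe_nnreal] at h1
    rw [← h1]
    refine setLIntegral_congr_fun measurableSet_Ioi fun s hs => ?_
    have : ENNReal.ofReal s < (h : ℝ≥0∞) ↔ s < h := by
      rw [← ENNReal.ofReal_coe_nnreal]
      exact ENNReal.ofReal_lt_ofReal_iff_of_nonneg (Set.mem_Ioi.1 hs).le
    simp only [this]

/-- Hölder with the conjugate exponent `q = 2n/(n-1) > 2`, for which the tail of the kernel is in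
`L^q`. Beyond radius `R` its `L^q` norm is a constant times `R^{(2-q)/q} = R^{-1/n}`, so the radius
`s⁻ⁿ` is the one that makes the bound linear in `s`. -/
theorem exists_rieszOp_far_le (n : ℕ) (hn : 2 ≤ n) :
    ∃ C : ℝ, 0 < C ∧ ∀ f : ℂ → ℝ≥0∞, Measurable f →
      ∫⁻ z, f z ^ (2 * n / (n + 1) : ℝ) ≤ 1 → ∀ s : ℝ, 0 < s → ∀ w : ℂ,
        ∫⁻ z, f z * (if (s ^ n)⁻¹ < ‖w - z‖ then ‖w - z‖ₑ⁻¹ else 0) ≤ ENNReal.ofReal (C * s) := by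
  have hn' : (2 : ℝ) ≤ n := by exact_mod_cast hn
  have hn1 : (0 : ℝ) < n - 1 := by linarith
  set q : ℝ := 2 * n / (n - 1) with hq
  have hq2 : 2 < q := by rw [hq, lt_div_iff₀ hn1]; linarith
  have hpq : (2 * n / (n + 1) : ℝ).HolderConjugate q := by
    rw [Real.holderConjugate_iff]
    constructor
    · rw [lt_div_iff₀ (by positivity)]; linarith
    · rw [hq]; field_simp; ring
  refine ⟨(2 * Real.pi / (q - 2)) ^ (1 / q), by
    have : 0 < q - 2 := by linarith
    positivity, fun f hf h1 s hs w => ?_⟩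
  have hk : Measurable fun z : ℂ => if (s ^ n)⁻¹ < ‖w - z‖ then ‖w - z‖ₑ⁻¹ else 0 :=
    Measurable.ite (measurableSet_lt (by fun_prop) (by fun_prop)) (by fun_prop) measurable_const
  refine (ENNReal.lintegral_mul_le_Lp_mul_Lq volume hpq hf.aemeasurable hk.aemeasurable).trans ?_
  have h2 : ∫⁻ z : ℂ, (if (s ^ n)⁻¹ < ‖w - z‖ then ‖w - z‖ₑ⁻¹ else 0) ^ q =
      ENNReal.ofReal (2 * Real.pi * (((s ^ n)⁻¹) ^ (2 - q) / (q - 2))) := by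
    rw [← lintegral_enorm_inv_rpow_compl_ball hq2 (by positivity : 0 < (s ^ n)⁻¹),
      ← lintegral_sub_left_eq_self (fun z : ℂ => (if (s ^ n)⁻¹ < ‖w - z‖ then ‖w - z‖ₑ⁻¹ else 0) ^ q) w]
    refine lintegral_congr fun z => ?_
    rw [sub_sub_cancel]
    split_ifs
    · rfl
    · exact ENNReal.zero_rpow_of_pos (zero_lt_two.trans hq2)
  rw [h2]
  have hq0 : 0 < q - 2 := by linarith
  calc _ ≤ 1 ^ (1 / (2 * n / (n + 1) : ℝ)) *
      ENNReal.ofReal (2 * Real.pi * (((s ^ n)⁻¹) ^ (2 - q) / (q - 2))) ^ (1 / q) := by gcongr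
    _ = _ := by
      rw [ENNReal.one_rpow, one_mul, ENNReal.ofReal_rpow_of_pos (by positivity),
        ← mul_div_assoc, mul_div_right_comm, Real.mul_rpow (by positivity) (by positivity)]
      congr 2
      rw [← Real.rpow_natCast, ← Real.rpow_neg hs.le, ← Real.rpow_mul hs.le, ← Real.rpow_mul hs.le]
      convert Real.rpow_one s using 2
      rw [hq]; field_simp; ring

/-- The truncation step of real interpolation. The far part contributes at most `Cs`. In the near
part, values of `f` up to the threshold `γ` contribute at most `γ · 2π s⁻ⁿ = Cs/2`, which is how `γ`
is chosen. Where the potential exceeds `2Cs`, the large values of `f` must account for the remaining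
`Cs/2`. -/
theorem rieszOp_le_of_lt {n : ℕ} {C : ℝ} (hC : 0 < C) {f : ℂ → ℝ≥0∞} (hf : Measurable f)
    {s : ℝ} (hs : 0 < s) {w : ℂ}
    (hfar : ∫⁻ z, f z * (if (s ^ n)⁻¹ < ‖w - z‖ then ‖w - z‖ₑ⁻¹ else 0) ≤ ENNReal.ofReal (C * s))
    (hlt : ENNReal.ofReal (2 * C * s) < rieszOp f w) :
    ENNReal.ofReal (C * s / 2) ≤ ∫⁻ z, (if ENNReal.ofReal (C * s ^ (n + 1) / (4 * Real.pi)) < f z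
      then f z else 0) * (if ‖w - z‖ ≤ (s ^ n)⁻¹ then ‖w - z‖ₑ⁻¹ else 0) := by
  set γ : ℝ≥0∞ := ENNReal.ofReal (C * s ^ (n + 1) / (4 * Real.pi)) with hγ
  have hnear : ∫⁻ z : ℂ, γ * (if ‖w - z‖ ≤ (s ^ n)⁻¹ then ‖w - z‖ₑ⁻¹ else 0) =
      ENNReal.ofReal (C * s / 2) := by
    rw [lintegral_const_mul _ (Measurable.ite (measurableSet_le (by fun_prop) (by fun_prop))
      (by fun_prop) measurable_const), lintegral_sub_left_eq_self
      (fun z : ℂ => if ‖z‖ ≤ (s ^ n)⁻¹ then ‖z‖ₑ⁻¹ else 0) w, lintegral_enorm_inv_ball, hγ,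
      ← ENNReal.ofReal_mul (by positivity)]
    congr 1
    field_simp
    ring
  have hle : rieszOp f w ≤ ENNReal.ofReal (C * s) + ENNReal.ofReal (C * s / 2) +
      ∫⁻ z, (if γ < f z then f z else 0) * (if ‖w - z‖ ≤ (s ^ n)⁻¹ then ‖w - z‖ₑ⁻¹ else 0) := by
    refine le_trans ?_ (add_le_add (add_le_add hfar hnear.le) le_rfl)
    have hm : Measurable fun z : ℂ => if (s ^ n)⁻¹ < ‖w - z‖ then ‖w - z‖ₑ⁻¹ else 0 :=
      Measurable.ite (measurableSet_lt (by fun_prop) (by fun_prop)) (by fun_prop) measurable_const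
    have hm' : Measurable fun z : ℂ => if ‖w - z‖ ≤ (s ^ n)⁻¹ then ‖w - z‖ₑ⁻¹ else 0 :=
      Measurable.ite (measurableSet_le (by fun_prop) (by fun_prop)) (by fun_prop) measurable_const
    have hm1 : Measurable fun z => f z * (if (s ^ n)⁻¹ < ‖w - z‖ then ‖w - z‖ₑ⁻¹ else 0) :=
      hf.mul hm
    rw [← lintegral_add_left hm1, ← lintegral_add_left (f := fun z => f z * (if (s ^ n)⁻¹ < ‖w - z‖ then ‖w - z‖ₑ⁻¹ else 0) +
        γ * (if ‖w - z‖ ≤ (s ^ n)⁻¹ then ‖w - z‖ₑ⁻¹ else 0)) (hm1.add (hm'.const_mul _))]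
    refine lintegral_mono fun z => ?_
    by_cases h1 : (s ^ n)⁻¹ < ‖w - z‖
    · simp [h1, not_le.2 h1]
    · by_cases h2 : γ < f z
      · simp [h1, not_lt.1 h1, h2]
      · simp only [h1, not_lt.1 h1, h2, if_true, if_false, mul_zero, zero_add, zero_mul, add_zero]
        gcongr
        exact not_lt.1 h2
  have hlt' := hlt.trans_le hle
  rw [show 2 * C * s = (C * s + C * s / 2) + C * s / 2 by ring,
    ENNReal.ofReal_add (by positivity) (by positivity),
    ENNReal.ofReal_add (by positivity) (by positivity)] at hlt'
  exact (lt_of_add_lt_add_left hlt').le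

/-- Tonelli: `w` and `z` change places while the level `s` stays in the middle. -/
theorem lintegral_swap_outer_inner {α β γ : Type*} [MeasurableSpace α] [MeasurableSpace β]
    [MeasurableSpace γ] {μ : Measure α} {ν : Measure β} {κ : Measure γ} [SFinite μ] [SFinite ν]
    [SFinite κ] {B : α → β → γ → ℝ≥0∞} (hB : Measurable fun p : α × β × γ => B p.1 p.2.1 p.2.2) :
    ∫⁻ w, ∫⁻ s, ∫⁻ z, B s w z ∂κ ∂μ ∂ν = ∫⁻ z, ∫⁻ s, ∫⁻ w, B s w z ∂ν ∂μ ∂κ := by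
  have hB' : Measurable fun p : (β × γ) × α => B p.2 p.1.1 p.1.2 :=
    hB.comp (by fun_prop : Measurable fun p : (β × γ) × α => (p.2, p.1.1, p.1.2))
  have e1 : ∀ w, ∫⁻ s, ∫⁻ z, B s w z ∂κ ∂μ = ∫⁻ z, ∫⁻ s, B s w z ∂μ ∂κ := fun w =>
    lintegral_lintegral_swap (hB.comp (by fun_prop :
      Measurable fun p : α × γ => (p.1, w, p.2))).aemeasurable
  have e2 : ∀ z, ∫⁻ s, ∫⁻ w, B s w z ∂ν ∂μ = ∫⁻ w, ∫⁻ s, B s w z ∂μ ∂ν := fun z =>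
    lintegral_lintegral_swap (hB.comp (by fun_prop :
      Measurable fun p : α × β => (p.1, p.2, z))).aemeasurable
  simp only [e1, e2]
  exact lintegral_lintegral_swap (Measurable.lintegral_prod_right' hB').aemeasurable

/-- The Hardy–Littlewood–Sobolev inequality in the plane for the Riesz potential of order one,
with target exponent `2 n`, for normalised functions. -/
theorem exists_lintegral_rieszOp_pow_le_of_le_one (n : ℕ) (hn : 2 ≤ n) :
    ∃ C : ℝ≥0∞, C ≠ ∞ ∧ ∀ f : ℂ → ℝ≥0∞, Measurable f →
      ∫⁻ z, f z ^ (2 * n / (n + 1) : ℝ) ≤ 1 → ∫⁻ w, rieszOp f w ^ (2 * n) ≤ C := by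
  obtain ⟨C, hC, hfar⟩ := exists_rieszOp_far_le n hn
  -- With `n = k + 2` the powers `2n - 1`, `2n - 2` and `n - 2` of `s` used below involve no
  -- subtraction.
  obtain ⟨k, rfl⟩ : ∃ k, n = k + 2 := ⟨n - 2, by omega⟩
  set c : ℝ := (4 * Real.pi) / C with hc
  have hc0 : 0 < c := by positivity
  have hC2 : ENNReal.ofReal (2 * C) ≠ 0 := by simp [hC]
  have hCh : ENNReal.ofReal (C / 2) ≠ 0 := by simp [hC]
  let K : ℝ≥0∞ := ENNReal.ofReal (2 * C) ^ (2 * (k + 2)) * ((2 * k + 4 : ℕ) *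
    ((ENNReal.ofReal (C / 2))⁻¹ * (ENNReal.ofReal (2 * Real.pi) *
      (ENNReal.ofReal c ^ ((k + 1) / (k + 3) : ℝ)))))
  refine ⟨K, ?_, fun f hf h1 => ?_⟩
  · simp only [K]
    refine ENNReal.mul_ne_top (by finiteness) (ENNReal.mul_ne_top (ENNReal.natCast_ne_top _)
      (ENNReal.mul_ne_top (by simpa using hC) (ENNReal.mul_ne_top (by finiteness) ?_)))
    exact ENNReal.rpow_ne_top_of_nonneg (by positivity) (by simp)
  -- the truncated near part of the potential at level `s`
  let A : ℝ → ℂ → ℂ → ℝ≥0∞ := fun s w z =>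
    (if ENNReal.ofReal (C * s ^ (k + 2 + 1) / (4 * Real.pi)) < f z then f z else 0) *
      (if ‖w - z‖ ≤ (s ^ (k + 2))⁻¹ then ‖w - z‖ₑ⁻¹ else 0)
  have hA : Measurable fun p : ℝ × ℂ × ℂ => A p.1 p.2.1 p.2.2 := by
    refine Measurable.mul (Measurable.ite (measurableSet_lt (by fun_prop) (by fun_prop))
      (by fun_prop) measurable_const) (Measurable.ite (measurableSet_le (by fun_prop)
      (by fun_prop)) (by fun_prop) measurable_const)
  -- Layer cake for the potential divided by `2C`. At each active level one of the `2k + 3` factors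
  -- `s` is traded for the near integral, which is at least `Cs/2` there.
  have hpt : ∀ w, rieszOp f w ^ (2 * (k + 2)) ≤ ENNReal.ofReal (2 * C) ^ (2 * (k + 2)) *
      ((2 * k + 4 : ℕ) * ((ENNReal.ofReal (C / 2))⁻¹ *
        ∫⁻ s in Set.Ioi (0 : ℝ), ENNReal.ofReal s ^ (2 * k + 2) * ∫⁻ z, A s w z)) := by
    intro w
    have h2 := lintegral_Ioi_ofReal_pow_indicator (2 * k + 3) (rieszOp f w / ENNReal.ofReal (2 * C))
    rw [ENNReal.eq_div_iff (Nat.cast_ne_zero.2 (by omega)) (ENNReal.natCast_ne_top _)] at h2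
    have h3 : rieszOp f w = ENNReal.ofReal (2 * C) * (rieszOp f w / ENNReal.ofReal (2 * C)) :=
      (ENNReal.mul_div_cancel hC2 ENNReal.ofReal_ne_top).symm
    rw [h3, mul_pow, show 2 * (k + 2) = 2 * k + 3 + 1 by ring, ← h2]
    gcongr
    rw [← lintegral_const_mul']
    swap
    · simpa using hC
    refine setLIntegral_mono' measurableSet_Ioi fun s hs => ?_
    have hs : 0 < s := hs
    split_ifs with hlt
    swap
    · exact zero_le
    have hlt' : ENNReal.ofReal (2 * C * s) < rieszOp f w := by
      rw [ENNReal.lt_div_iff_mul_lt (.inl hC2) (.inl ENNReal.ofReal_ne_top), ← ENNReal.ofReal_mul hs.le] at hlt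
      rwa [mul_comm]
    have h4 := rieszOp_le_of_lt hC hf hs (hfar f hf h1 s hs w) hlt'
    rw [pow_succ, mul_left_comm]
    gcongr
    rw [mul_div_right_comm, ENNReal.ofReal_mul (by positivity)] at h4
    rw [← ENNReal.div_le_iff' (by simp) (by simpa using hC), div_eq_mul_inv, inv_inv, mul_comm]
    exact h4
  -- Integrating the kernel in `w` first gives `2π s^{-(k+2)}`, which leaves `s ^ k`. The truncation
  -- on `f z` reads `s < (c f z)^{1/(k+3)}`, so the `s`-integral produces `f z` to the power `1 +
  -- (k+1)/(k+3) = 2n/(n+1)`.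
  have hs_int : ∀ z, ∫⁻ s in Set.Ioi (0 : ℝ), ENNReal.ofReal s ^ (2 * k + 2) * ∫⁻ w, A s w z ≤
      ENNReal.ofReal (2 * Real.pi) * (ENNReal.ofReal c ^ ((k + 1) / (k + 3) : ℝ) *
        f z ^ (2 * (k + 2 : ℕ) / ((k + 2 : ℕ) + 1) : ℝ)) := by
    intro z
    have h2 := lintegral_Ioi_ofReal_pow_indicator k ((ENNReal.ofReal c * f z) ^ (1 / (k + 3) : ℝ))
    calc ∫⁻ s in Set.Ioi (0 : ℝ), ENNReal.ofReal s ^ (2 * k + 2) * ∫⁻ w, A s w z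
      _ = ∫⁻ s in Set.Ioi (0 : ℝ), ENNReal.ofReal (2 * Real.pi) * (f z *
          (if ENNReal.ofReal s < (ENNReal.ofReal c * f z) ^ (1 / (k + 3) : ℝ) then
            ENNReal.ofReal s ^ k else 0)) := by
        refine setLIntegral_congr_fun measurableSet_Ioi fun s hs => ?_
        have hs : 0 < s := hs
        have h3 : ∫⁻ w, A s w z = (if ENNReal.ofReal (C * s ^ (k + 2 + 1) / (4 * Real.pi)) < f z
            then f z else 0) * ENNReal.ofReal (2 * Real.pi * (s ^ (k + 2))⁻¹) := by
          simp only [A]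
          rw [lintegral_const_mul _ (Measurable.ite (measurableSet_le (by fun_prop) (by fun_prop))
            (by fun_prop) measurable_const), lintegral_sub_right_eq_self
            (fun z : ℂ => if ‖z‖ ≤ (s ^ (k + 2))⁻¹ then ‖z‖ₑ⁻¹ else 0) z, lintegral_enorm_inv_ball]
        have h4 : ENNReal.ofReal (C * s ^ (k + 2 + 1) / (4 * Real.pi)) < f z ↔
            ENNReal.ofReal s < (ENNReal.ofReal c * f z) ^ (1 / (k + 3) : ℝ) := by
          rw [one_div, ENNReal.lt_rpow_inv_iff (by positivity),
            show C * s ^ (k + 2 + 1) / (4 * Real.pi) = s ^ (k + 3) / c by rw [hc]; field_simp,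
            ENNReal.ofReal_div_of_pos hc0, ENNReal.div_lt_iff (by simp [hc0]) (by simp),
            ENNReal.ofReal_pow hs.le, mul_comm (f z)]
          norm_cast
        simp only [h3, h4]
        split_ifs
        swap
        · simp
        rw [ENNReal.ofReal_mul (by positivity), show 2 * k + 2 = k + (k + 2) by ring, pow_add,
          ENNReal.ofReal_inv_of_pos (by positivity), ENNReal.ofReal_pow hs.le]
        have : ENNReal.ofReal s ^ (k + 2) * (ENNReal.ofReal s ^ (k + 2))⁻¹ = 1 :=
          ENNReal.mul_inv_cancel (by simp [hs]) (by simp)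
        calc _ = ENNReal.ofReal (2 * Real.pi) * (f z * ENNReal.ofReal s ^ k) *
          (ENNReal.ofReal s ^ (k + 2) * (ENNReal.ofReal s ^ (k + 2))⁻¹) := by ring
          _ = _ := by rw [this, mul_one]
      _ = ENNReal.ofReal (2 * Real.pi) * (f z * (((ENNReal.ofReal c * f z) ^ (1 / (k + 3) : ℝ)) ^
          (k + 1) / (k + 1 : ℕ))) := by
        rw [← h2, lintegral_const_mul' _ _ (by finiteness), lintegral_const_mul]
        exact Measurable.ite (measurableSet_lt (by fun_prop) (by fun_prop)) (by fun_prop)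
          measurable_const
      _ ≤ _ := by
        refine mul_le_mul_right (le_trans (mul_le_mul_right (ENNReal.div_le_of_le_mul
          (le_mul_of_one_le_right' (by exact_mod_cast Nat.succ_pos k))) _) (le_of_eq ?_)) _
        rw [← ENNReal.rpow_natCast, ← ENNReal.rpow_mul,
          ENNReal.mul_rpow_of_nonneg _ _ (by positivity), mul_left_comm]
        congr 1
        · congr 1; push_cast; ring
        · nth_rw 1 [← ENNReal.rpow_one (f z)]
          rw [← ENNReal.rpow_add_of_nonneg _ _ (by positivity) (by positivity)]
          congr 1; push_cast; field_simp; ring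
  calc ∫⁻ w, rieszOp f w ^ (2 * (k + 2))
    _ ≤ ∫⁻ w, ENNReal.ofReal (2 * C) ^ (2 * (k + 2)) *
      ((2 * k + 4 : ℕ) * ((ENNReal.ofReal (C / 2))⁻¹ *
        ∫⁻ s in Set.Ioi (0 : ℝ), ENNReal.ofReal s ^ (2 * k + 2) * ∫⁻ z, A s w z)) :=
      lintegral_mono hpt
    _ = ENNReal.ofReal (2 * C) ^ (2 * (k + 2)) * ((2 * k + 4 : ℕ) * ((ENNReal.ofReal (C / 2))⁻¹ *
        ∫⁻ w, ∫⁻ s in Set.Ioi (0 : ℝ), ENNReal.ofReal s ^ (2 * k + 2) * ∫⁻ z, A s w z)) := by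
      rw [lintegral_const_mul', lintegral_const_mul', lintegral_const_mul']
      · simpa using hC
      · exact ENNReal.natCast_ne_top _
      · finiteness
    _ = ENNReal.ofReal (2 * C) ^ (2 * (k + 2)) * ((2 * k + 4 : ℕ) * ((ENNReal.ofReal (C / 2))⁻¹ *
        ∫⁻ z, ∫⁻ s in Set.Ioi (0 : ℝ), ENNReal.ofReal s ^ (2 * k + 2) * ∫⁻ w, A s w z)) := by
      congr 3
      simp only [← lintegral_const_mul' _ _ (ENNReal.pow_ne_top ENNReal.ofReal_ne_top)]
      exact lintegral_swap_outer_inner (by fun_prop)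
    _ ≤ ENNReal.ofReal (2 * C) ^ (2 * (k + 2)) * ((2 * k + 4 : ℕ) * ((ENNReal.ofReal (C / 2))⁻¹ *
        ∫⁻ z, ENNReal.ofReal (2 * Real.pi) * (ENNReal.ofReal c ^ ((k + 1) / (k + 3) : ℝ) *
        f z ^ (2 * (k + 2 : ℕ) / ((k + 2 : ℕ) + 1) : ℝ)))) := by
      gcongr with z
      exact hs_int z
    _ ≤ K := by
      rw [lintegral_const_mul', lintegral_const_mul']
      · simp only [K]
        gcongr
        exact mul_le_of_le_one_right' h1
      · exact ENNReal.rpow_ne_top_of_nonneg (by positivity) (by simp)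
      · finiteness

/-- The Hardy–Littlewood–Sobolev inequality in the plane for the Riesz potential of order one,
with target exponent `2 n`. -/
theorem exists_lintegral_rieszOp_pow_le (n : ℕ) (hn : 2 ≤ n) :
    ∃ C : ℝ≥0∞, C ≠ ∞ ∧ ∀ f : ℂ → ℝ≥0∞, Measurable f →
      ∫⁻ w, rieszOp f w ^ (2 * n) ≤ C * (∫⁻ z, f z ^ (2 * n / (n + 1) : ℝ)) ^ (n + 1) := by
  obtain ⟨C, hC, h⟩ := exists_lintegral_rieszOp_pow_le_of_le_one n hn
  have hn0 : (0 : ℝ) < n := by exact_mod_cast (by omega : 0 < n)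
  set r : ℝ := 2 * n / (n + 1) with hr
  have hr0 : 0 < r := by positivity
  -- A nonzero constant keeps the right-hand side infinite when the integral of `f ^ r` is infinite.
  refine ⟨C + 1, by simpa using hC, fun f hf => ?_⟩
  set I := ∫⁻ z, f z ^ r with hI
  by_cases h0 : I = 0
  · have hf0 : ∀ᵐ z, f z ≤ (fun _ => 0 : ℂ → ℝ≥0∞) z := by
      rw [hI, lintegral_eq_zero_iff (by fun_prop)] at h0
      filter_upwards [h0] with z hz
      simpa [hr0.not_gt, hr0] using hz
    have h1 : ∀ w, rieszOp f w = 0 := fun w =>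
      le_antisymm ((rieszOp_mono hf0 w).trans (by simp [rieszOp])) zero_le
    simp [h1, show n ≠ 0 by omega]
  by_cases ht : I = ∞
  · rw [ht, ENNReal.top_pow (by simp), ENNReal.mul_top (by simp)]
    exact le_top
  have hIr0 : I ^ (1 / r) ≠ 0 := by simp [h0, ht]
  have hIrt : I ^ (1 / r) ≠ ∞ := ENNReal.rpow_ne_top_of_nonneg (by positivity) ht
  -- Homogeneity: `f` is normalised to have unit integral of its `r`-th power; undoing this costs
  -- `I^{2n/r} = I^{n+1}`.
  have h1 := h (fun z => (I ^ (1 / r))⁻¹ * f z) (by fun_prop) (by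
    simp only [ENNReal.mul_rpow_of_nonneg _ _ hr0.le]
    rw [lintegral_const_mul _ (by fun_prop), ← ENNReal.inv_rpow, ← ENNReal.rpow_mul,
      one_div_mul_cancel hr0.ne', ENNReal.rpow_one]
    exact (ENNReal.inv_mul_cancel h0 ht).le)
  simp only [rieszOp_const_mul hf, mul_pow] at h1
  rw [lintegral_const_mul _ ((measurable_rieszOp hf).pow_const _), ← ENNReal.inv_pow,
    ← ENNReal.div_eq_inv_mul, ENNReal.div_le_iff (pow_ne_zero _ hIr0) (ENNReal.pow_ne_top hIrt)]
    at h1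
  refine h1.trans ?_
  have h2 : (I ^ (1 / r)) ^ (2 * n) = I ^ (n + 1) := by
    rw [← ENNReal.rpow_natCast, ← ENNReal.rpow_mul, ← ENNReal.rpow_natCast]
    congr 1
    rw [hr]; push_cast; field_simp
  rw [h2]
  gcongr
  exact le_self_add

/-- `f ↦ rieszOp (W f)` is bounded on `L^{2n}` when `W` is square integrable. -/
theorem exists_lintegral_rieszOp_mul_pow_le (n : ℕ) (hn : 2 ≤ n) :
    ∃ C : ℝ≥0∞, C ≠ ∞ ∧ ∀ W f : ℂ → ℝ≥0∞, Measurable W → Measurable f →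
      ∫⁻ w, rieszOp (fun z => W z * f z) w ^ (2 * n) ≤
        C * (∫⁻ z, W z ^ 2) ^ n * ∫⁻ z, f z ^ (2 * n) := by
  obtain ⟨C, hC, h⟩ := exists_lintegral_rieszOp_pow_le n hn
  have hn0 : (0 : ℝ) < n := by exact_mod_cast (by omega : 0 < n)
  refine ⟨C, hC, fun W f hW hf => (h _ (hW.mul hf)).trans ?_⟩
  rw [mul_assoc]
  gcongr
  -- Hölder between `W²` and `f^{2n}` with weights `n/(n+1)` and `1/(n+1)`: a product of `L²` and
  -- `L^{2n}` lies in `L^{2n/(n+1)}`.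
  have h1 := ENNReal.lintegral_mul_norm_pow_le (μ := volume) (f := fun z => W z ^ 2)
    (g := fun z => f z ^ (2 * n)) (p := n / (n + 1)) (q := 1 / (n + 1)) (by fun_prop) (by fun_prop)
    (by positivity) (by positivity) (by field_simp)
  have h2 : ∀ z, (W z ^ 2) ^ (n / (n + 1) : ℝ) * (f z ^ (2 * n)) ^ (1 / (n + 1) : ℝ) =
      (W z * f z) ^ (2 * n / (n + 1) : ℝ) := by
    intro z
    rw [ENNReal.mul_rpow_of_nonneg _ _ (by positivity), ← ENNReal.rpow_natCast,
      ← ENNReal.rpow_natCast, ← ENNReal.rpow_mul, ← ENNReal.rpow_mul]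
    congr 2 <;> (push_cast; ring)
  simp only [h2] at h1
  refine (pow_le_pow_left' h1 (n + 1)).trans (le_of_eq ?_)
  rw [mul_pow, ← ENNReal.rpow_natCast, ← ENNReal.rpow_natCast, ← ENNReal.rpow_mul,
    ← ENNReal.rpow_mul, ← ENNReal.rpow_natCast]
  have h3 : ((n + 1 : ℕ) : ℝ) = n + 1 := by push_cast; ring
  rw [h3, div_mul_cancel₀ _ (by positivity), div_mul_cancel₀ _ (by positivity), ENNReal.rpow_one]

theorem lintegral_Lp_nat_add_le {f g : ℂ → ℝ≥0∞} (hf : Measurable f) (hg : Measurable g) {p : ℕ}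
    (hp : 1 ≤ p) :
    (∫⁻ z, (f z + g z) ^ p) ^ (1 / p : ℝ) ≤
      (∫⁻ z, f z ^ p) ^ (1 / p : ℝ) + (∫⁻ z, g z ^ p) ^ (1 / p : ℝ) := by
  have := ENNReal.lintegral_Lp_add_le (μ := volume) hf.aemeasurable hg.aemeasurable
    (p := p) (by exact_mod_cast hp)
  simpa only [Pi.add_apply, ENNReal.rpow_natCast] using this

/-! ### Self-improvement from `L⁴` to `L⁸`, and the passage to a uniform bound. -/

/-- A self-improvement principle: if a function in `L⁴` is bounded by its image under a small
critical perturbation plus a function in `L⁸`, then it is in `L⁸`. -/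
theorem exists_smallness_rieszOp : ∃ ε : ℝ≥0∞, 0 < ε ∧ ∀ W U g : ℂ → ℝ≥0∞,
    Measurable W → Measurable U → Measurable g →
    ∫⁻ z, W z ^ 2 ≤ ε → ∫⁻ z, U z ^ 4 < ∞ → ∫⁻ z, g z ^ 8 < ∞ →
    (∀ᵐ w, U w ≤ g w + rieszOp (fun z => W z * U z) w) → ∫⁻ z, U z ^ 8 < ∞ := by
  obtain ⟨C₄, hC₄, h₄⟩ := exists_lintegral_rieszOp_mul_pow_le 2 le_rfl
  obtain ⟨C₈, hC₈, h₈⟩ := exists_lintegral_rieszOp_mul_pow_le 4 (by norm_num)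
  norm_num at h₄ h₈
  -- Since `δ^{1/8} = 1/2`, the operator `T` below halves `L⁸` norms; in `L⁴` it is enough that `δ <
  -- 1`.
  let δ : ℝ≥0∞ := (2 ^ 8 : ℝ≥0∞)⁻¹
  have hδ0 : 0 < δ := by simp [δ]
  let ε : ℝ≥0∞ := min 1 (min (δ / (C₄ + 1)) (δ / (C₈ + 1)))
  have hε1 : ε ≤ 1 := min_le_left _ _
  have hε4 : (C₄ + 1) * ε ≤ δ := by
    refine (mul_le_mul_right ((min_le_right _ _).trans (min_le_left _ _)) _).trans ?_
    exact ENNReal.mul_div_le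
  have hε8 : (C₈ + 1) * ε ≤ δ := by
    refine (mul_le_mul_right ((min_le_right _ _).trans (min_le_right _ _)) _).trans ?_
    exact ENNReal.mul_div_le
  refine ⟨ε, by
    simp only [ε, lt_min_iff]
    exact ⟨one_pos, ENNReal.div_pos hδ0.ne' (by simpa using hC₄),
      ENNReal.div_pos hδ0.ne' (by simpa using hC₈)⟩, fun W U g hW hU hg hWε hU4 hg8 hle => ?_⟩
  have small : ∀ {C : ℝ≥0∞} {k : ℕ}, k ≠ 0 → (C + 1) * ε ≤ δ →
      C * (∫⁻ z, W z ^ 2) ^ k ≤ δ := by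
    intro C k hk hC
    refine le_trans ?_ hC
    gcongr
    · exact le_self_add
    · exact (pow_le_pow_left' hWε k).trans (pow_le_of_le_one zero_le hε1 hk)
  let T : (ℂ → ℝ≥0∞) → ℂ → ℝ≥0∞ := fun f => rieszOp (fun z => W z * f z)
  have hTm : ∀ {f}, Measurable f → Measurable (T f) := fun hf => measurable_rieszOp (hW.mul hf)
  have hT4 : ∀ {f}, Measurable f → ∫⁻ z, T f z ^ 4 ≤ δ * ∫⁻ z, f z ^ 4 := fun hf =>
    (h₄ W _ hW hf).trans (mul_le_mul_left (small two_ne_zero hε4) _)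
  have hT8 : ∀ {f}, Measurable f → ∫⁻ z, T f z ^ 8 ≤ δ * ∫⁻ z, f z ^ 8 := fun hf =>
    (h₈ W _ hW hf).trans (mul_le_mul_left (small four_ne_zero hε8) _)
  -- The `L⁸` norm of `U` may be infinite, so the term `T U` cannot be absorbed on the left. Instead
  -- `U ≤ S N + D N`, where the Picard sums `S N` increase and are bounded in `L⁸` by twice the norm
  -- of `g`, and the remainder `D N = Tᴺ U` tends to zero because of the contraction in `L⁴`.
  let S : ℕ → ℂ → ℝ≥0∞ := fun N => (fun f z => g z + T f z)^[N] g
  have hS : ∀ N, S (N + 1) = fun z => g z + T (S N) z := fun N =>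
    Function.iterate_succ_apply' _ _ _
  let D : ℕ → ℂ → ℝ≥0∞ := fun N => T^[N] U
  have hD : ∀ N, D (N + 1) = T (D N) := fun N => Function.iterate_succ_apply' _ _ _
  have hSm : ∀ N, Measurable (S N) := by
    intro N
    induction N with
    | zero => exact hg
    | succ N ih => rw [hS]; exact hg.add (hTm ih)
  have hDm : ∀ N, Measurable (D N) := by
    intro N
    induction N with
    | zero => exact hU
    | succ N ih => rw [hD]; exact hTm ih
  have hSmono : Monotone S := by
    refine monotone_nat_of_le_succ fun N => ?_
    induction N with
    | zero => rw [hS]; exact fun z => le_self_add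
    | succ N ih =>
      rw [hS, hS (N + 1)]
      exact fun z => add_le_add le_rfl
        (rieszOp_mono (.of_forall fun z => mul_le_mul_right (ih z) _) z)
  have hUSD : ∀ N, ∀ᵐ w, U w ≤ S N w + D N w := by
    intro N
    induction N with
    | zero => exact .of_forall fun w => le_add_self
    | succ N ih =>
      filter_upwards [hle] with w hw
      refine hw.trans ?_
      rw [hS, hD, add_assoc]
      gcongr
      simp only [T]
      rw [← rieszOp_add (f := fun z => W z * S N z) (hW.mul (hSm N))]
      refine rieszOp_mono (ih.mono fun z hz => ?_) w
      rw [← mul_add]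
      gcongr
  have hD4 : ∀ N, ∫⁻ z, D N z ^ 4 ≤ δ ^ N * ∫⁻ z, U z ^ 4 := by
    intro N
    induction N with
    | zero => simp [D]
    | succ N ih =>
      rw [hD, pow_succ', mul_assoc]
      exact (hT4 (hDm N)).trans (mul_le_mul_right ih _)
  -- The integrals of `D N ^ 4` decay geometrically, so the sum of these powers is finite almost
  -- everywhere; no subsequence is needed.
  have hDlim : ∀ᵐ z, Filter.Tendsto (fun N => D N z) Filter.atTop (nhds 0) := by
    have h1 : ∫⁻ z, ∑' N, D N z ^ 4 ≠ ∞ := by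
      rw [lintegral_tsum fun N => ((hDm N).pow_const _).aemeasurable]
      refine ne_top_of_le_ne_top ?_ (ENNReal.tsum_le_tsum hD4)
      rw [ENNReal.tsum_mul_right, ENNReal.tsum_geometric]
      refine ENNReal.mul_ne_top ?_ hU4.ne
      rw [ENNReal.inv_ne_top, ne_eq, tsub_eq_zero_iff_le, not_le]
      simp only [δ, ENNReal.inv_lt_one]
      norm_num
    filter_upwards [ae_lt_top (Measurable.tsum fun N => (hDm N).pow_const 4) h1] with z hz
    have h2 := ENNReal.tendsto_atTop_zero_of_tsum_ne_top hz.ne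
    have h3 := h2.ennrpow_const (4 : ℝ)⁻¹
    rw [ENNReal.zero_rpow_of_pos (by norm_num)] at h3
    refine h3.congr fun N => ?_
    rw [← ENNReal.rpow_natCast, ← ENNReal.rpow_mul]
    norm_num
  let G : ℝ≥0∞ := (∫⁻ z, g z ^ 8) ^ (1 / (8 : ℕ) : ℝ)
  have hS8 : ∀ N, (∫⁻ z, S N z ^ 8) ^ (1 / (8 : ℕ) : ℝ) ≤ 2 * G := by
    intro N
    induction N with
    | zero => exact le_mul_of_one_le_left' one_le_two
    | succ N ih =>
      rw [hS, two_mul]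
      refine (lintegral_Lp_nat_add_le hg (hTm (hSm N)) (by norm_num)).trans ?_
      gcongr
      refine (ENNReal.rpow_le_rpow (hT8 (hSm N)) (by norm_num)).trans ?_
      rw [ENNReal.mul_rpow_of_nonneg _ _ (by norm_num)]
      refine (mul_le_mul_right ih _).trans (le_of_eq ?_)
      rw [← mul_assoc]
      convert one_mul G
      simp only [δ]
      rw [ENNReal.inv_rpow, ← ENNReal.rpow_natCast, ← ENNReal.rpow_mul]
      norm_num
      exact ENNReal.inv_mul_cancel two_ne_zero ENNReal.ofNat_ne_top
  have hfin : ∀ᵐ z, U z ≤ ⨆ N, S N z := by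
    filter_upwards [hDlim, ae_all_iff.2 hUSD] with z hz hle
    have h1 : ∀ N, U z ≤ (⨆ N, S N z) + D N z := fun N =>
      (hle N).trans (by gcongr; exact le_iSup (fun N => S N z) N)
    have h2 := (tendsto_const_nhds (x := ⨆ N, S N z)).add hz
    rw [add_zero] at h2
    exact ge_of_tendsto' h2 h1
  have hG : G ≠ ∞ := ENNReal.rpow_ne_top_of_nonneg (by norm_num) hg8.ne
  calc ∫⁻ z, U z ^ 8 ≤ ∫⁻ z, ⨆ N, S N z ^ 8 := by
        refine lintegral_mono_ae (hfin.mono fun z hz => ?_)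
        rw [← ENNReal.iSup_pow]
        gcongr
    _ = ⨆ N, ∫⁻ z, S N z ^ 8 := by
        refine lintegral_iSup (fun N => (hSm N).pow_const _) fun N M h z => ?_
        dsimp only
        gcongr
        exact hSmono h z
    _ ≤ (2 * G) ^ 8 := by
        refine iSup_le fun N => ?_
        have := pow_le_pow_left' (hS8 N) 8
        rwa [← ENNReal.rpow_natCast, ← ENNReal.rpow_mul, one_div_mul_cancel (by norm_num),
          ENNReal.rpow_one] at this
    _ < ∞ := (ENNReal.pow_ne_top (by finiteness)).lt_top

/-- Uniform bound for the Riesz potential of an integrable function in `L^q`, `q > 2`. -/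
theorem exists_rieszOp_le {p q : ℝ} (hpq : p.HolderConjugate q) (hp : 2 < p) :
    ∃ C : ℝ≥0∞, C ≠ ∞ ∧ ∀ f : ℂ → ℝ≥0∞, Measurable f → ∀ w,
      rieszOp f w ≤ (∫⁻ z, f z ^ p) ^ (1 / p) * C + ∫⁻ z, f z := by
  -- The kernel is split at radius one: the near part is in `L^q` because `p > 2` forces `q < 2`,
  -- and the far part is at most one.
  let k : ℂ → ℝ≥0∞ := fun z => if ‖z‖ ≤ 1 then ‖z‖ₑ⁻¹ else 0
  have hk : Measurable k := Measurable.ite (measurableSet_le (by fun_prop) (by fun_prop))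
    (by fun_prop) measurable_const
  refine ⟨(∫⁻ z, k z ^ q) ^ (1 / q), ?_, fun f hf w => ?_⟩
  · refine ENNReal.rpow_ne_top_of_nonneg (by simpa using hpq.symm.nonneg) ?_
    have hq0 : 0 < q := hpq.symm.pos
    have hq2 : q < 2 := by
      rw [hpq.conjugate_eq, div_lt_iff₀ (by linarith)]
      linarith
    have h := lintegral_complex_radial
      (g := fun r => (if r ≤ 1 then (ENNReal.ofReal r)⁻¹ else 0) ^ q)
      ((Measurable.ite measurableSet_Iic (by fun_prop) measurable_const).pow_const _)
    simp only [ofReal_norm] at h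
    simp only [k]
    rw [h]
    refine ENNReal.mul_ne_top ENNReal.ofReal_ne_top ?_
    have : ∀ r ∈ Set.Ioi (0 : ℝ), ENNReal.ofReal r *
        (if r ≤ 1 then (ENNReal.ofReal r)⁻¹ else 0) ^ q
        = (Set.Iic 1).indicator (fun r => ENNReal.ofReal (r ^ (1 - q))) r := by
      intro r hr
      have hr : 0 < r := hr
      by_cases h : r ≤ 1
      · simp only [h, if_true, Set.mem_Iic, Set.indicator_of_mem]
        rw [← ENNReal.ofReal_inv_of_pos hr, ENNReal.ofReal_rpow_of_pos (by positivity),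
          ← ENNReal.ofReal_mul hr.le, Real.rpow_sub hr, Real.rpow_one, Real.inv_rpow hr.le]
        rfl
      · simp [h, hq0]
    rw [setLIntegral_congr_fun measurableSet_Ioi this, setLIntegral_indicator measurableSet_Iic,
      Set.inter_comm, Set.Ioi_inter_Iic]
    have h2 : IntegrableOn (fun r : ℝ => r ^ (1 - q)) (Set.Ioc 0 1) :=
      (intervalIntegral.intervalIntegrable_rpow' (by linarith)).1
    exact h2.lintegral_lt_top.ne
  · have h1 := ENNReal.lintegral_mul_le_Lp_mul_Lq volume hpq hf.aemeasurable
      (hk.comp (by fun_prop : Measurable fun z => w - z)).aemeasurable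
    have h2 : ∫⁻ z, (k ∘ fun z => w - z) z ^ q = ∫⁻ z, k z ^ q :=
      lintegral_sub_left_eq_self (fun z => k z ^ q) w
    rw [h2] at h1
    refine le_trans ?_ (add_le_add h1 le_rfl)
    rw [← lintegral_add_right _ hf]
    refine lintegral_mono fun z => ?_
    simp only [Pi.mul_apply, Function.comp, k]
    split_ifs with h
    · exact le_self_add
    · rw [mul_zero, zero_add]
      refine mul_le_of_le_one_right' (ENNReal.inv_le_one.2 ?_)
      rw [← ofReal_norm]
      exact ENNReal.one_le_ofReal.2 (not_le.1 h).le

/-! ### The operator `dbar` and the Cauchy–Pompeiu formula. -/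

/-- Twice the Wirtinger derivative `∂/∂z̄`, applied classically. -/
noncomputable def dbar (φ : ℂ → ℂ) (z : ℂ) : ℂ :=
  fderiv ℝ φ z 1 + Complex.I * fderiv ℝ φ z Complex.I

/-- `dbar u = G` in the sense of distributions. -/
def WeakDbar (u G : ℂ → ℂ) : Prop :=
  ∀ φ : ℂ → ℂ, ContDiff ℝ (⊤ : ℕ∞) φ → HasCompactSupport φ →
    ∫ z, u z * dbar φ z = -∫ z, G z * φ z

theorem continuous_dbar {φ : ℂ → ℂ} (hφ : ContDiff ℝ 1 φ) : Continuous (dbar φ) := by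
  have := hφ.continuous_fderiv one_ne_zero
  unfold dbar
  fun_prop

theorem contDiff_dbar {φ : ℂ → ℂ} (hφ : ContDiff ℝ (⊤ : ℕ∞) φ) :
    ContDiff ℝ (⊤ : ℕ∞) (dbar φ) := by
  have : ContDiff ℝ (⊤ : ℕ∞) (fderiv ℝ φ) := hφ.fderiv_right (by simp)
  unfold dbar
  exact (this.clm_apply contDiff_const).add (contDiff_const.mul (this.clm_apply contDiff_const))

theorem support_dbar_subset (φ : ℂ → ℂ) : Function.support (dbar φ) ⊆ tsupport φ := by
  intro z hz
  refine support_fderiv_subset ℝ (f := φ) ?_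
  contrapose! hz
  simp only [Function.mem_support, ne_eq, not_not] at hz
  simp [dbar, hz]

theorem hasCompactSupport_dbar {φ : ℂ → ℂ} (hφ : HasCompactSupport φ) :
    HasCompactSupport (dbar φ) :=
  hφ.mono' (support_dbar_subset φ)

theorem dbar_mul {f g : ℂ → ℂ} {z : ℂ} (hf : DifferentiableAt ℝ f z)
    (hg : DifferentiableAt ℝ g z) :
    dbar (fun z => f z * g z) z = f z * dbar g z + dbar f z * g z := by
  simp only [dbar, fderiv_fun_mul hf hg, add_apply, smul_apply, smul_eq_mul]
  ring

theorem hasDerivAt_comp_ray {φ : ℂ → ℂ} (hφ : ContDiff ℝ 1 φ) (θ r : ℝ) :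
    HasDerivAt (fun r : ℝ => φ (r * Complex.exp (θ * Complex.I)))
      (fderiv ℝ φ (r * Complex.exp (θ * Complex.I)) (Complex.exp (θ * Complex.I))) r := by
  have h1 : HasDerivAt (fun r : ℝ => (r : ℂ) * Complex.exp (θ * Complex.I))
      (Complex.exp (θ * Complex.I)) r := by
    simpa using (Complex.ofRealCLM.hasDerivAt (x := r)).mul_const (Complex.exp (θ * Complex.I))
  exact ((hφ.differentiable one_ne_zero) _).hasFDerivAt.comp_hasDerivAt r h1

theorem hasDerivAt_comp_circle {φ : ℂ → ℂ} (hφ : ContDiff ℝ 1 φ) (r θ : ℝ) :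
    HasDerivAt (fun θ : ℝ => φ (r * Complex.exp (θ * Complex.I)))
      (r • fderiv ℝ φ (r * Complex.exp (θ * Complex.I)) (Complex.I * Complex.exp (θ * Complex.I)))
      θ := by
  have h1 : HasDerivAt (fun θ : ℝ => (r : ℂ) * Complex.exp (θ * Complex.I))
      (r • (Complex.I * Complex.exp (θ * Complex.I))) θ := by
    have h2 : HasDerivAt (fun θ : ℝ => (θ : ℂ) * Complex.I) Complex.I θ := by
      simpa using (Complex.ofRealCLM.hasDerivAt (x := θ)).mul_const Complex.I
    exact (h2.cexp.const_mul (r : ℂ)).congr_deriv (by rw [Complex.real_smul]; ring)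
  rw [← map_smul]
  exact ((hφ.differentiable one_ne_zero) _).hasFDerivAt.comp_hasDerivAt θ h1

/-- The polar form of `dbar`: at `z = r e^{iθ}` with `r > 0`, it says `e^{-iθ} dbar = ∂_r + (i/r)
∂_θ`. -/
theorem exp_neg_mul_dbar (φ : ℂ → ℂ) (z : ℂ) (θ : ℝ) :
    Complex.exp (-(θ * Complex.I)) * dbar φ z =
      fderiv ℝ φ z (Complex.exp (θ * Complex.I)) +
      Complex.I * fderiv ℝ φ z (Complex.I * Complex.exp (θ * Complex.I)) := by
  have key : ∀ a b : ℝ, fderiv ℝ φ z (a + b * Complex.I) =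
      a * fderiv ℝ φ z 1 + b * fderiv ℝ φ z Complex.I := by
    intro a b
    rw [show (a + b * Complex.I : ℂ) = a • (1 : ℂ) + b • Complex.I by simp, map_add, map_smul,
      map_smul]
    simp
  have e1 : Complex.exp (θ * Complex.I) = (Real.cos θ : ℂ) + (Real.sin θ : ℂ) * Complex.I := by
    rw [Complex.exp_mul_I]; simp
  have e2 : Complex.I * Complex.exp (θ * Complex.I) =
      ((-Real.sin θ : ℝ) : ℂ) + (Real.cos θ : ℂ) * Complex.I := by
    rw [e1, Complex.ofReal_neg]; linear_combination (Real.sin θ : ℂ) * Complex.I_sq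
  have e3 : Complex.exp (-(θ * Complex.I)) = (Real.cos θ : ℂ) - (Real.sin θ : ℂ) * Complex.I := by
    rw [← neg_mul, Complex.exp_mul_I]; simp [sub_eq_add_neg]
  rw [e2, e1, e3, key, key, dbar]
  push_cast
  linear_combination (-Complex.sin θ * fderiv ℝ φ z Complex.I) * Complex.I_sq

/-- The Cauchy–Pompeiu formula for compactly supported functions, at the origin. -/
theorem integral_dbar_mul_inv {φ : ℂ → ℂ} (hφ : ContDiff ℝ 1 φ) (hc : HasCompactSupport φ) :
    ∫ z, dbar φ z * z⁻¹ = -(2 * Real.pi * φ 0) := by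
  obtain ⟨R, hR⟩ : ∃ R : ℝ, ∀ z, R < ‖z‖ → z ∉ tsupport φ := by
    obtain ⟨R, hR⟩ := hc.isCompact.isBounded.subset_closedBall (0 : ℂ)
    exact ⟨R, fun z hz h => hz.not_ge (by simpa using hR h)⟩
  have hfd : ∀ z, R < ‖z‖ → fderiv ℝ φ z = 0 := fun z hz => by
    by_contra h
    exact hR z hz (support_fderiv_subset ℝ h)
  have hcont := hφ.continuous_fderiv one_ne_zero
  -- The Jacobian `r` cancels the singularity of `1/z` and leaves `e^{-iθ} dbar φ = A + B`. The
  -- radial part `A` integrates along each ray to `-φ 0`; the angular part `B` integrates to zero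
  -- over each circle by periodicity.
  let A : ℝ × ℝ → ℂ := fun p => fderiv ℝ φ (p.1 * Complex.exp (p.2 * Complex.I))
    (Complex.exp (p.2 * Complex.I))
  let B : ℝ × ℝ → ℂ := fun p => Complex.I * fderiv ℝ φ (p.1 * Complex.exp (p.2 * Complex.I))
    (Complex.I * Complex.exp (p.2 * Complex.I))
  have hint : ∀ F : ℝ × ℝ → ℂ, Continuous F →
      (∀ p, fderiv ℝ φ (p.1 * Complex.exp (p.2 * Complex.I)) = 0 → F p = 0) →
      IntegrableOn F (Set.Ioi (0 : ℝ) ×ˢ Set.Ioo (-Real.pi) Real.pi) := by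
    intro F hF hF0
    have h1 : IntegrableOn F (Set.Icc 0 R ×ˢ Set.Icc (-Real.pi) Real.pi) :=
      hF.continuousOn.integrableOn_compact (isCompact_Icc.prod isCompact_Icc)
    refine h1.of_forall_sdiff_eq_zero (measurableSet_Ioi.prod measurableSet_Ioo) ?_
    rintro ⟨r, θ⟩ ⟨⟨hr, hθ⟩, hn⟩
    refine hF0 _ (hfd _ ?_)
    have hr : 0 < r := hr
    by_contra hle
    refine hn ⟨⟨hr.le, ?_⟩, Set.Ioo_subset_Icc_self hθ⟩
    simpa [Complex.norm_exp_ofReal_mul_I, abs_of_pos hr] using hle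
  have hA : IntegrableOn A (Set.Ioi (0 : ℝ) ×ˢ Set.Ioo (-Real.pi) Real.pi) :=
    hint A (by fun_prop) fun p h => by simp [A, h]
  have hB : IntegrableOn B (Set.Ioi (0 : ℝ) ×ˢ Set.Ioo (-Real.pi) Real.pi) :=
    hint B (by fun_prop) fun p h => by simp [B, h]
  rw [← Complex.integral_comp_polarCoord_symm, polarCoord_target]
  have h1 : ∀ p ∈ Set.Ioi (0 : ℝ) ×ˢ Set.Ioo (-Real.pi) Real.pi,
      p.1 • (dbar φ (Complex.polarCoord.symm p) * (Complex.polarCoord.symm p)⁻¹) = A p + B p := by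
    rintro ⟨r, θ⟩ ⟨hr, -⟩
    have hr : (r : ℂ) ≠ 0 := by exact_mod_cast (Set.mem_Ioi.1 hr).ne'
    have e : Complex.polarCoord.symm (r, θ) = r * Complex.exp (θ * Complex.I) := by
      rw [Complex.polarCoord_symm_apply, Complex.exp_mul_I]; simp
    simp only [A, B]
    rw [← exp_neg_mul_dbar, e, Complex.exp_neg, Complex.real_smul]
    field_simp
  rw [setIntegral_congr_fun (measurableSet_Ioi.prod measurableSet_Ioo) h1, integral_add hA hB]
  rw [Measure.volume_eq_prod] at hA hB ⊢
  have hBz : ∫ p in Set.Ioi (0 : ℝ) ×ˢ Set.Ioo (-Real.pi) Real.pi, B p ∂(volume.prod volume) = 0 := by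
    rw [setIntegral_prod _ hB]
    refine setIntegral_eq_zero_of_forall_eq_zero fun r hr => ?_
    have hr : r ≠ 0 := (Set.mem_Ioi.1 hr).ne'
    rw [← integral_Ioc_eq_integral_Ioo,
      ← intervalIntegral.integral_of_le (by linarith [Real.pi_pos])]
    simp only [B]
    rw [intervalIntegral.integral_const_mul]
    have h2 := intervalIntegral.integral_eq_sub_of_hasDerivAt (a := -Real.pi) (b := Real.pi)
      (fun θ _ => hasDerivAt_comp_circle hφ r θ)
      (Continuous.intervalIntegrable (by fun_prop) _ _)
    rw [intervalIntegral.integral_smul] at h2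
    have h3 : Complex.exp ((Real.pi : ℝ) * Complex.I) = Complex.exp ((-Real.pi : ℝ) * Complex.I) := by
      push_cast
      rw [neg_mul, Complex.exp_neg, Complex.exp_pi_mul_I]; norm_num
    rw [h3, sub_self, smul_eq_zero] at h2
    rw [h2.resolve_left hr, mul_zero]
  have hAz : ∫ p in Set.Ioi (0 : ℝ) ×ˢ Set.Ioo (-Real.pi) Real.pi, A p ∂(volume.prod volume) =
      -(2 * Real.pi * φ 0) := by
    rw [← setIntegral_prod_swap, setIntegral_prod _ ?_]
    swap
    · exact hA.swap
    have h2 : ∀ θ : ℝ, ∫ r in Set.Ioi (0 : ℝ), A (Prod.swap (θ, r)) = -φ 0 := by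
      intro θ
      have hcs : HasCompactSupport fun r : ℝ => φ (r * Complex.exp (θ * Complex.I)) := by
        refine HasCompactSupport.of_support_subset_isCompact (isCompact_Icc (a := -R) (b := R)) ?_
        intro r hr
        rw [Set.mem_Icc, ← abs_le]
        by_contra hle
        refine hR _ ?_ (subset_tsupport φ hr)
        simpa [Complex.norm_exp_ofReal_mul_I] using hle
      have hcd : ContDiff ℝ 1 fun r : ℝ => φ (r * Complex.exp (θ * Complex.I)) :=
        hφ.comp (Complex.ofRealCLM.contDiff.mul contDiff_const)
      have h3 := hcs.integral_Ioi_deriv_eq hcd 0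
      simp only [(hasDerivAt_comp_ray hφ θ _).deriv] at h3
      simpa using h3
    simp only [h2]
    rw [setIntegral_const, Measure.real, Real.volume_Ioo]
    rw [ENNReal.toReal_ofReal (by linarith [Real.pi_pos])]
    rw [Complex.real_smul]; push_cast; ring
  rw [hAz, hBz, add_zero]

theorem integral_dbar_mul_inv_sub {φ : ℂ → ℂ} (hφ : ContDiff ℝ 1 φ) (hc : HasCompactSupport φ)
    (w : ℂ) : ∫ z, dbar φ z * (w - z)⁻¹ = 2 * Real.pi * φ w := by
  have h := integral_dbar_mul_inv (φ := fun z => φ (w - z)) (by fun_prop)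
    (hc.comp_homeomorph (Homeomorph.subLeft w))
  have h1 : ∀ z, dbar (fun z => φ (w - z)) z = -dbar φ (w - z) := by
    intro z
    have : fderiv ℝ (fun z => φ (w - z)) z = -(fderiv ℝ φ (w - z)) := by
      have h2 := ((hφ.differentiable one_ne_zero) (w - z)).hasFDerivAt.comp z
        ((hasFDerivAt_id z).const_sub w)
      exact h2.fderiv.trans (by ext; simp)
    simp only [dbar, this, neg_apply]
    ring
  simp only [h1, sub_zero, neg_mul, integral_neg, neg_inj] at h
  rw [← h, ← integral_sub_left_eq_self _ volume w]
  simp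

/-! ### The Cauchy transform and representation of weak solutions. -/

/-- The Cauchy kernel, the fundamental solution of `dbar`. -/
noncomputable def cauchyKernel (z : ℂ) : ℂ := (2 * Real.pi : ℂ)⁻¹ * z⁻¹

theorem measurable_cauchyKernel : Measurable cauchyKernel := by
  unfold cauchyKernel; fun_prop

theorem cauchyKernel_neg (z : ℂ) : cauchyKernel (-z) = -cauchyKernel z := by
  simp [cauchyKernel, inv_neg]

theorem enorm_cauchyKernel_le (z : ℂ) : ‖cauchyKernel z‖ₑ ≤ ‖z‖ₑ⁻¹ := by
  by_cases hz : z = 0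
  · simp [hz]
  · rw [cauchyKernel, enorm_mul, enorm_inv hz]
    refine mul_le_of_le_one_left' ?_
    rw [← ofReal_norm, ENNReal.ofReal_le_one, norm_inv]
    have h : ‖(2 * Real.pi : ℂ)‖ = 2 * Real.pi := by simp [abs_of_pos Real.pi_pos]
    rw [h]
    exact inv_le_one_of_one_le₀ (by linarith [Real.pi_gt_three])

theorem locallyIntegrable_cauchyKernel : LocallyIntegrable cauchyKernel := by
  intro x
  refine ⟨Metric.closedBall 0 (‖x‖ + 1), ?_, measurable_cauchyKernel.aestronglyMeasurable, ?_⟩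
  · exact Filter.mem_of_superset (Metric.ball_mem_nhds x one_pos) fun y hy => by
      have := norm_le_norm_add_norm_sub' y x
      rw [Metric.mem_ball, dist_eq_norm] at hy
      simp only [Metric.mem_closedBall, dist_zero_right]
      linarith
  · rw [hasFiniteIntegral_iff_enorm, ← lintegral_indicator Metric.isClosed_closedBall.measurableSet]
    refine lt_of_le_of_lt (lintegral_mono fun z => ?_)
      ((lintegral_enorm_inv_ball (‖x‖ + 1)).trans_lt ENNReal.ofReal_lt_top)
    by_cases h : ‖z‖ ≤ ‖x‖ + 1
    · simpa [h] using enorm_cauchyKernel_le z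
    · simp [h]

/-- The Cauchy transform of a test function. -/
noncomputable def cauchyTransform (φ : ℂ → ℂ) (w : ℂ) : ℂ := ∫ z, φ z * cauchyKernel (w - z)

theorem cauchyTransform_eq_convolution (φ : ℂ → ℂ) :
    cauchyTransform φ = φ ⋆[ContinuousLinearMap.mul ℝ ℂ] cauchyKernel := rfl

theorem contDiff_cauchyTransform {φ : ℂ → ℂ} (hφ : ContDiff ℝ (⊤ : ℕ∞) φ)
    (hc : HasCompactSupport φ) : ContDiff ℝ (⊤ : ℕ∞) (cauchyTransform φ) := by
  rw [cauchyTransform_eq_convolution]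
  exact hc.contDiff_convolution_left _ hφ locallyIntegrable_cauchyKernel

/-- The derivatives of the convolution fall on `φ`, and what remains is the Cauchy–Pompeiu formula
for `φ`. -/
theorem dbar_cauchyTransform {φ : ℂ → ℂ} (hφ : ContDiff ℝ (⊤ : ℕ∞) φ)
    (hc : HasCompactSupport φ) (w : ℂ) : dbar (cauchyTransform φ) w = φ w := by
  have hφ1 : ContDiff ℝ 1 φ := hφ.of_le (by simp)
  have h1 := (hc.hasFDerivAt_convolution_left (ContinuousLinearMap.mul ℝ ℂ) hφ1
    locallyIntegrable_cauchyKernel w).fderiv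
  have h2 : ∀ v, fderiv ℝ (cauchyTransform φ) w v =
      ∫ z, fderiv ℝ φ z v * cauchyKernel (w - z) := by
    intro v
    rw [cauchyTransform_eq_convolution, h1, convolution_def, ContinuousLinearMap.integral_apply]
    · simp [ContinuousLinearMap.precompL, mul_comm]
    · exact (HasCompactSupport.convolutionExists_left _ (hc.fderiv ℝ)
        (hφ1.continuous_fderiv one_ne_zero) locallyIntegrable_cauchyKernel w).integrable
  have h3 : ∀ v, Integrable fun z => fderiv ℝ φ z v * cauchyKernel (w - z) := by
    intro v
    exact (HasCompactSupport.convolutionExists_left (ContinuousLinearMap.mul ℝ ℂ)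
      (hc.fderiv_apply ℝ v) (by have := hφ1.continuous_fderiv one_ne_zero; fun_prop)
      locallyIntegrable_cauchyKernel w).integrable
  rw [dbar, h2, h2, ← integral_const_mul, ← integral_add (h3 1) ((h3 _).const_mul _)]
  have h4 := integral_dbar_mul_inv_sub hφ1 hc w
  have h5 : ∀ z, fderiv ℝ φ z 1 * cauchyKernel (w - z) +
      Complex.I * (fderiv ℝ φ z Complex.I * cauchyKernel (w - z)) =
      (2 * Real.pi : ℂ)⁻¹ * (dbar φ z * (w - z)⁻¹) := by
    intro z; simp only [dbar, cauchyKernel]; ring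
  simp only [h5]
  rw [integral_const_mul, h4]
  have : (Real.pi : ℂ) ≠ 0 := by exact_mod_cast Real.pi_ne_zero
  field_simp

theorem exists_smooth_cutoff {K : Set ℂ} (hK : IsCompact K) :
    ∃ η : ℂ → ℂ, ContDiff ℝ (⊤ : ℕ∞) η ∧ HasCompactSupport η ∧
      ∃ U, IsOpen U ∧ K ⊆ U ∧ ∀ z ∈ U, η z = 1 := by
  obtain ⟨R, hR⟩ := hK.isBounded.subset_ball (0 : ℂ)
  have hR' : (0 : ℝ) < max R 1 := lt_max_of_lt_right one_pos
  let b : ContDiffBump (0 : ℂ) := ⟨max R 1, max R 1 + 1, hR', by linarith⟩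
  refine ⟨fun z => (b z : ℂ), Complex.ofRealCLM.contDiff.comp b.contDiff,
    b.hasCompactSupport.comp_left (g := Complex.ofReal) Complex.ofReal_zero,
    Metric.ball 0 (max R 1), Metric.isOpen_ball,
    hR.trans (Metric.ball_subset_ball (le_max_left _ _)), fun z hz => ?_⟩
  change (b z : ℂ) = 1
  rw [b.one_of_mem_closedBall (Metric.ball_subset_closedBall hz), Complex.ofReal_one]

theorem lintegral_rpow_lt_top_of_hasCompactSupport {φ : ℂ → ℂ} (hφ : Continuous φ)
    (hc : HasCompactSupport φ) {p : ℝ} (hp : 0 < p) : ∫⁻ z, ‖φ z‖ₑ ^ p < ∞ := by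
  have h := (hφ.memLp_of_hasCompactSupport (μ := volume) (p := ENNReal.ofReal p) hc).2
  rw [eLpNorm_lt_top_iff_lintegral_rpow_enorm_lt_top (by simpa using hp) (by simp)] at h
  simpa [ENNReal.toReal_ofReal hp.le] using h

/-- The hypothesis for Fubini: the potential of `|φ|` is bounded uniformly in the other variable by
`exists_rieszOp_le`, here with exponent 4, and `G` is integrable. -/
theorem integrable_prod_cauchyKernel {G φ : ℂ → ℂ} (hG : Integrable G) (hφ : Continuous φ)
    (hc : HasCompactSupport φ) :
    Integrable (fun p : ℂ × ℂ => G p.1 * (φ p.2 * cauchyKernel (p.1 - p.2)))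
      (volume.prod volume) := by
  have hpq : (4 : ℝ).HolderConjugate (4 / 3) := by
    rw [Real.holderConjugate_iff]; norm_num
  obtain ⟨C, hC, h⟩ := exists_rieszOp_le hpq (by norm_num)
  have hφm : Measurable fun z => ‖φ z‖ₑ := by fun_prop
  have hm : AEStronglyMeasurable (fun p : ℂ × ℂ => G p.1 * (φ p.2 * cauchyKernel (p.1 - p.2)))
      (volume.prod volume) := by
    refine hG.aestronglyMeasurable.comp_fst.mul (Measurable.aestronglyMeasurable ?_)
    have := measurable_cauchyKernel
    fun_prop
  refine ⟨hm, ?_⟩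
  rw [hasFiniteIntegral_iff_enorm, lintegral_prod _ hm.enorm]
  let M : ℝ≥0∞ := (∫⁻ z, ‖φ z‖ₑ ^ (4 : ℝ)) ^ (1 / (4 : ℝ)) * C + ∫⁻ z, ‖φ z‖ₑ
  have hM : M ≠ ∞ := by
    refine ENNReal.add_ne_top.2 ⟨ENNReal.mul_ne_top (ENNReal.rpow_ne_top_of_nonneg (by norm_num)
      (lintegral_rpow_lt_top_of_hasCompactSupport hφ hc (by norm_num)).ne) hC, ?_⟩
    simpa using (lintegral_rpow_lt_top_of_hasCompactSupport hφ hc one_pos).ne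
  calc _ ≤ ∫⁻ w, ‖G w‖ₑ * M := by
        refine lintegral_mono fun w => ?_
        simp only [enorm_mul]
        rw [lintegral_const_mul' _ _ enorm_ne_top]
        gcongr
        refine le_trans ?_ (h _ hφm w)
        refine lintegral_mono fun z => ?_
        gcongr
        exact enorm_cauchyKernel_le _
    _ < ∞ := by
        rw [lintegral_mul_const' _ _ hM]
        exact ENNReal.mul_lt_top hG.2 hM.lt_top

/-- A compactly supported integrable function is the Cauchy transform of its weak `dbar`
derivative. -/
theorem WeakDbar.ae_eq_cauchyTransform {u G : ℂ → ℂ} (h : WeakDbar u G) (hu : Integrable u)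
    (hG : Integrable G) (huc : HasCompactSupport u) (hGc : HasCompactSupport G) :
    ∀ᵐ w, u w = cauchyTransform G w := by
  have hprod : ∀ φ : ℂ → ℂ, Continuous φ → HasCompactSupport φ → Integrable (fun p : ℂ × ℂ =>
      φ p.1 * (G p.2 * cauchyKernel (p.1 - p.2))) (volume.prod volume) := by
    intro φ hφ hc
    refine (integrable_prod_cauchyKernel hG hφ hc).swap.neg.congr (.of_forall fun p => ?_)
    simp only [Pi.neg_apply, Function.comp, Prod.swap]
    rw [← neg_sub, cauchyKernel_neg]
    ring
  have hint : ∀ φ : ℂ → ℂ, Continuous φ → HasCompactSupport φ →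
      Integrable fun w => φ w * cauchyTransform G w := by
    intro φ hφ hc
    refine (hprod φ hφ hc).integral_prod_left.congr (.of_forall fun w => ?_)
    simp only [integral_const_mul]
    rfl
  refine ae_eq_of_integral_contDiff_smul_eq hu.locallyIntegrable ?_ fun g hg hgc => ?_
  · intro x
    obtain ⟨η, hη, hηc, U, hU, hxU, h1⟩ := exists_smooth_cutoff (isCompact_singleton (x := x))
    refine ⟨U, hU.mem_nhds (hxU rfl), ?_⟩
    exact (hint η hη.continuous hηc).integrableOn.congr_fun
      (fun z hz => by simp [h1 z hz]) hU.measurableSet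
  · let φ : ℂ → ℂ := fun z => (g z : ℂ)
    have hφ : ContDiff ℝ (⊤ : ℕ∞) φ := Complex.ofRealCLM.contDiff.comp hg
    have hφc : HasCompactSupport φ := hgc.comp_left (g := Complex.ofReal) Complex.ofReal_zero
    -- The Cauchy transform of a test function need not have compact support. It is cut off by an
    -- `η` equal to one near the supports of `u` and `G`, where nothing changes. Testing then gives
    -- `∫ φ u = -∫ G · cauchyTransform φ`, and Fubini with the oddness of the kernel moves the
    -- transform onto `G`.
    obtain ⟨η, hη, hηc, U, hU, hKU, h1⟩ :=
      exists_smooth_cutoff (huc.isCompact.union hGc.isCompact)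
    have hΦ := contDiff_cauchyTransform hφ hφc
    have ht := h (fun z => η z * cauchyTransform φ z) (hη.mul hΦ) hηc.mul_right
    have e1 : ∀ z, u z * dbar (fun z => η z * cauchyTransform φ z) z = g z • u z := by
      intro z
      by_cases hz : u z = 0
      · simp [hz]
      have hzU : z ∈ U := hKU (.inl (subset_tsupport u hz))
      have : (fun z => η z * cauchyTransform φ z) =ᶠ[nhds z] cauchyTransform φ := by
        filter_upwards [hU.mem_nhds hzU] with y hy
        simp [h1 y hy]
      rw [dbar, this.fderiv_eq, ← dbar, dbar_cauchyTransform hφ hφc, mul_comm]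
      rfl
    have e2 : ∀ z, G z * (η z * cauchyTransform φ z) = G z * cauchyTransform φ z := by
      intro z
      by_cases hz : G z = 0
      · simp [hz]
      rw [h1 z (hKU (.inr (subset_tsupport G hz))), one_mul]
    simp only [e1, e2] at ht
    rw [ht]
    have e3 : ∫ w, G w * cauchyTransform φ w =
        ∫ w, ∫ z, G w * (φ z * cauchyKernel (w - z)) := by
      simp only [integral_const_mul]; rfl
    rw [e3, integral_integral_swap (integrable_prod_cauchyKernel hG hφ.continuous hφc),
      ← integral_neg]
    congr 1 with z
    rw [← integral_neg, Complex.real_smul, cauchyTransform, ← integral_const_mul]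
    congr 1 with w
    rw [← neg_sub, cauchyKernel_neg]
    simp only [φ]
    ring

theorem WeakDbar.ae_enorm_le_rieszOp {u G : ℂ → ℂ} (h : WeakDbar u G) (hu : Integrable u)
    (hG : Integrable G) (huc : HasCompactSupport u) (hGc : HasCompactSupport G) :
    ∀ᵐ w, ‖u w‖ₑ ≤ rieszOp (fun z => ‖G z‖ₑ) w := by
  filter_upwards [h.ae_eq_cauchyTransform hu hG huc hGc] with w hw
  rw [hw]
  refine (enorm_integral_le_lintegral_enorm _).trans (lintegral_mono fun z => ?_)
  rw [enorm_mul]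
  gcongr
  exact enorm_cauchyKernel_le _

/-- Localisation of a weak `dbar` equation. -/
theorem WeakDbar.mul_left {v G η : ℂ → ℂ} (h : WeakDbar v G) (hv : LocallyIntegrable v)
    (hη : ContDiff ℝ (⊤ : ℕ∞) η) (hG : LocallyIntegrable G) :
    WeakDbar (fun z => η z * v z) (fun z => η z * G z + dbar η z * v z) := by
  intro φ hφ hc
  have h1 := h (fun z => η z * φ z) (hη.mul hφ) hc.mul_left
  have e1 : ∀ z, v z * dbar (fun z => η z * φ z) z =
      η z * v z * dbar φ z + dbar η z * φ z * v z := by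
    intro z
    rw [dbar_mul (hη.differentiable (by simp) z) (hφ.differentiable (by simp) z)]
    ring
  have hηc := hη.continuous
  have hdη := continuous_dbar (hη.of_le (by simp) : ContDiff ℝ 1 η)
  have hdφ := continuous_dbar (hφ.of_le (by simp) : ContDiff ℝ 1 φ)
  have hφc := hφ.continuous
  have i1 : Integrable fun z => η z * v z * dbar φ z := by
    have := hv.integrable_smul_left_of_hasCompactSupport (g := fun z => η z * dbar φ z)
      (by fun_prop) (hasCompactSupport_dbar hc).mul_left
    refine this.congr (.of_forall fun z => ?_)
    simp only [smul_eq_mul]; ring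
  have i2 : Integrable fun z => dbar η z * φ z * v z := by
    have := hv.integrable_smul_left_of_hasCompactSupport (g := fun z => dbar η z * φ z)
      (by fun_prop) hc.mul_left
    exact this
  have i3 : Integrable fun z => G z * (η z * φ z) := by
    have := hG.integrable_smul_left_of_hasCompactSupport (g := fun z => η z * φ z)
      (by fun_prop) hc.mul_left
    refine this.congr (.of_forall fun z => ?_)
    simp only [smul_eq_mul]; ring
  simp only [e1] at h1
  rw [integral_add i1 i2] at h1
  rw [eq_sub_of_add_eq h1, ← neg_add', ← integral_add i3 i2]
  congr 2 with z
  ring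

/-! ### The cubic system: local integrability and local boundedness of solutions. -/

/-- The right-hand side of the cubic first order system `dbar vⱼ = αⱼ (|v|² + βⱼ) conj vⱼ₊₁`. -/
noncomputable def cubicRhs (α β : Fin 2 → ℂ) (v : Fin 2 → ℂ → ℂ) (j : Fin 2) (z : ℂ) : ℂ :=
  α j * ((v 0 z * conj (v 0 z) + v 1 z * conj (v 1 z) + β j) * conj (v (j + 1) z))

/-- The `ℓ¹` size of a pair of functions. -/
noncomputable def pairNorm (v : Fin 2 → ℂ → ℂ) (z : ℂ) : ℝ≥0∞ := ‖v 0 z‖ₑ + ‖v 1 z‖ₑ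

theorem enorm_le_pairNorm (v : Fin 2 → ℂ → ℂ) (j : Fin 2) (z : ℂ) : ‖v j z‖ₑ ≤ pairNorm v z := by
  fin_cases j
  · exact le_self_add
  · exact le_add_self

theorem measurable_pairNorm {v : Fin 2 → ℂ → ℂ} (hv : ∀ j, Measurable (v j)) :
    Measurable (pairNorm v) :=
  (hv 0).enorm.add (hv 1).enorm

theorem measurable_cubicRhs {α β : Fin 2 → ℂ} {v : Fin 2 → ℂ → ℂ} (hv : ∀ j, Measurable (v j))
    (j : Fin 2) : Measurable (cubicRhs α β v j) := by
  have h0 := hv 0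
  have h1 := hv 1
  have h2 := hv (j + 1)
  have hc : Measurable (fun z : ℂ => conj z) := Complex.continuous_conj.measurable
  unfold cubicRhs
  exact (((h0.mul (hc.comp h0)).add (h1.mul (hc.comp h1))).add_const _).mul (hc.comp h2)
    |>.const_mul _

theorem enorm_density_le (v : Fin 2 → ℂ → ℂ) (b : ℂ) (z : ℂ) :
    ‖v 0 z * conj (v 0 z) + v 1 z * conj (v 1 z) + b‖ₑ ≤ pairNorm v z ^ 2 + ‖b‖ₑ := by
  have hc : ∀ a : ℂ, ‖conj a‖ₑ = ‖a‖ₑ := fun a => by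
    rw [← ofReal_norm, RCLike.norm_conj, ofReal_norm]
  refine (enorm_add_le _ _).trans (add_le_add_left ?_ _)
  refine (enorm_add_le _ _).trans ?_
  rw [enorm_mul, enorm_mul, hc, hc, pairNorm, add_sq, sq, sq, add_right_comm]
  exact le_self_add

/-- The factor `a`, a cutoff in the main application, stays attached to `v (j + 1)`. The cubic term
is thereby read as linear in the cut-off unknown with coefficient of size `|v|²`, the form that
`exists_smallness_rieszOp` needs. -/
theorem enorm_mul_cubicRhs_le {α β : Fin 2 → ℂ} (hα : ∀ j, ‖α j‖ₑ ≤ 1) (v : Fin 2 → ℂ → ℂ)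
    (j : Fin 2) (a z : ℂ) :
    ‖a * cubicRhs α β v j z‖ₑ ≤ (pairNorm v z ^ 2 + ‖β j‖ₑ) * ‖a * v (j + 1) z‖ₑ := by
  have hc : ‖conj (v (j + 1) z)‖ₑ = ‖v (j + 1) z‖ₑ := by
    rw [← ofReal_norm, RCLike.norm_conj, ofReal_norm]
  rw [cubicRhs, enorm_mul, enorm_mul, enorm_mul, hc, enorm_mul]
  calc _ = ‖α j‖ₑ * (‖v 0 z * conj (v 0 z) + v 1 z * conj (v 1 z) + β j‖ₑ *
        (‖a‖ₑ * ‖v (j + 1) z‖ₑ)) := by ring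
    _ ≤ 1 * ((pairNorm v z ^ 2 + ‖β j‖ₑ) * (‖a‖ₑ * ‖v (j + 1) z‖ₑ)) := by
        gcongr
        · exact hα j
        · exact enorm_density_le v _ z
    _ = _ := one_mul _

theorem ENNReal.rpow_le_one_add_rpow (a : ℝ≥0∞) {p q : ℝ} (hp : 0 ≤ p) (hpq : p ≤ q) :
    a ^ p ≤ 1 + a ^ q := by
  rcases le_total a 1 with h | h
  · exact (ENNReal.rpow_le_one h hp).trans le_self_add
  · exact (ENNReal.rpow_le_rpow_of_exponent_le h hpq).trans le_add_self

theorem setLIntegral_one_add_lt_top {K : Set ℂ} (hK : IsCompact K) {f : ℂ → ℝ≥0∞}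
    (hf : ∫⁻ z in K, f z < ∞) : ∫⁻ z in K, (1 + f z) < ∞ := by
  rw [lintegral_add_left measurable_const]
  simpa using ⟨hK.measure_lt_top, hf⟩

theorem lintegral_rpow_lt_top_of_le_indicator {K : Set ℂ} (hK : MeasurableSet K)
    {f H : ℂ → ℝ≥0∞} {C : ℝ≥0∞} (hC : C ≠ ∞) {q : ℝ} (hq : 0 < q)
    (hle : ∀ z, f z ≤ C * K.indicator H z) (hH : ∫⁻ z in K, H z ^ q < ∞) :
    ∫⁻ z, f z ^ q < ∞ := by
  have : ∀ z, f z ^ q ≤ C ^ q * K.indicator (fun z => H z ^ q) z := by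
    intro z
    refine (ENNReal.rpow_le_rpow (hle z) hq.le).trans ?_
    rw [ENNReal.mul_rpow_of_nonneg _ _ hq.le]
    gcongr
    by_cases h : z ∈ K <;> simp [h, hq]
  refine (lintegral_mono this).trans_lt ?_
  have hC' : C ^ q ≠ ∞ := ENNReal.rpow_ne_top_of_nonneg hq.le hC
  rw [lintegral_const_mul' _ _ hC', lintegral_indicator hK]
  exact ENNReal.mul_lt_top hC'.lt_top hH

theorem exists_enorm_le_of_continuous {η : ℂ → ℂ} (hη : Continuous η) (hc : HasCompactSupport η) :
    ∃ C : ℝ≥0∞, C ≠ ∞ ∧ ∀ z, ‖η z‖ₑ ≤ C := by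
  obtain ⟨C, hC⟩ := hη.bounded_above_of_compact_support hc
  refine ⟨ENNReal.ofReal C, ENNReal.ofReal_ne_top, fun z => ?_⟩
  rw [← ofReal_norm]
  exact ENNReal.ofReal_le_ofReal (hC z)

theorem locallyIntegrable_of_setLIntegral_lt_top {f : ℂ → ℂ} (hf : Measurable f)
    (h : ∀ K : Set ℂ, IsCompact K → ∫⁻ z in K, ‖f z‖ₑ < ∞) : LocallyIntegrable f :=
  locallyIntegrable_iff.2 fun K hK => ⟨hf.aestronglyMeasurable, by
    rw [hasFiniteIntegral_iff_enorm]; exact h K hK⟩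

theorem enorm_cubicRhs_le {α β : Fin 2 → ℂ} (hα : ∀ j, ‖α j‖ₑ ≤ 1) (v : Fin 2 → ℂ → ℂ)
    (j : Fin 2) (z : ℂ) :
    ‖cubicRhs α β v j z‖ₑ ≤ (1 + ‖β j‖ₑ) * (1 + pairNorm v z ^ 3) := by
  have h := enorm_mul_cubicRhs_le (β := β) hα v j 1 z
  rw [one_mul, one_mul] at h
  set N := pairNorm v z
  have hN : N ≤ 1 + N ^ 3 := by
    have := ENNReal.rpow_le_one_add_rpow N (p := 1) (q := (3 : ℕ)) (by norm_num) (by norm_num)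
    rwa [ENNReal.rpow_one, ENNReal.rpow_natCast] at this
  calc _ ≤ (N ^ 2 + ‖β j‖ₑ) * N := h.trans (mul_le_mul_right (enorm_le_pairNorm v _ z) _)
    _ = N ^ 3 + ‖β j‖ₑ * N := by ring
    _ ≤ (1 + N ^ 3) + ‖β j‖ₑ * (1 + N ^ 3) := by gcongr; exact le_add_self
    _ = _ := by ring

section Regularity

variable {α β : Fin 2 → ℂ} {v : Fin 2 → ℂ → ℂ}

theorem setLIntegral_pairNorm_lt_top {p q : ℝ} (hp : 0 ≤ p) (hpq : p ≤ q) {K : Set ℂ}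
    (hK : IsCompact K) (h : ∫⁻ z in K, pairNorm v z ^ q < ∞) :
    ∫⁻ z in K, pairNorm v z ^ p < ∞ :=
  (lintegral_mono fun _ => ENNReal.rpow_le_one_add_rpow _ hp hpq).trans_lt
    (setLIntegral_one_add_lt_top hK h)

theorem setLIntegral_pairNorm_four_lt_top (h4 : ∫⁻ z, pairNorm v z ^ 4 < ∞) (K : Set ℂ) :
    ∫⁻ z in K, pairNorm v z ^ (4 : ℝ) < ∞ := by
  refine (setLIntegral_le_lintegral _ _).trans_lt ?_
  simpa only [ENNReal.rpow_ofNat] using h4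

theorem locallyIntegrable_component (hv : ∀ j, Measurable (v j))
    (h4 : ∫⁻ z, pairNorm v z ^ 4 < ∞) (j : Fin 2) : LocallyIntegrable (v j) :=
  locallyIntegrable_of_setLIntegral_lt_top (hv j) fun K hK => by
    refine (lintegral_mono (enorm_le_pairNorm v j)).trans_lt ?_
    simpa only [ENNReal.rpow_one] using setLIntegral_pairNorm_lt_top (p := 1) (q := 4)
      (by norm_num) (by norm_num) hK (setLIntegral_pairNorm_four_lt_top h4 K)

theorem locallyIntegrable_cubicRhs (hα : ∀ j, ‖α j‖ₑ ≤ 1) (hv : ∀ j, Measurable (v j))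
    (h4 : ∫⁻ z, pairNorm v z ^ 4 < ∞) (j : Fin 2) : LocallyIntegrable (cubicRhs α β v j) :=
  locallyIntegrable_of_setLIntegral_lt_top (measurable_cubicRhs hv j) fun K hK => by
    refine (lintegral_mono (enorm_cubicRhs_le hα v j)).trans_lt ?_
    rw [lintegral_const_mul' _ _ (by finiteness)]
    refine ENNReal.mul_lt_top (by finiteness) (setLIntegral_one_add_lt_top hK ?_)
    simpa only [ENNReal.rpow_ofNat] using setLIntegral_pairNorm_lt_top (p := 3) (q := 4)
      (by norm_num) (by norm_num) hK (setLIntegral_pairNorm_four_lt_top h4 K)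

/-- The localised equation. -/
theorem ae_enorm_cutoff_mul_le (hα : ∀ j, ‖α j‖ₑ ≤ 1) (hv : ∀ j, Measurable (v j))
    (h4 : ∫⁻ z, pairNorm v z ^ 4 < ∞) (hsol : ∀ j, WeakDbar (v j) (cubicRhs α β v j))
    {η : ℂ → ℂ} (hη : ContDiff ℝ (⊤ : ℕ∞) η) (hc : HasCompactSupport η) (j : Fin 2) :
    ∀ᵐ w, ‖η w * v j w‖ₑ ≤
      rieszOp (fun z => ‖η z * cubicRhs α β v j z + dbar η z * v j z‖ₑ) w := by
  have hv' := locallyIntegrable_component hv h4 j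
  have hG := locallyIntegrable_cubicRhs (β := β) hα hv h4 j
  have hdη := continuous_dbar (hη.of_le (by simp) : ContDiff ℝ 1 η)
  refine ((hsol j).mul_left hv' hη hG).ae_enorm_le_rieszOp ?_ ?_ hc.mul_right
    (hc.mul_right.add (hasCompactSupport_dbar hc).mul_right)
  · exact hv'.integrable_smul_left_of_hasCompactSupport hη.continuous hc
  · exact (hG.integrable_smul_left_of_hasCompactSupport hη.continuous hc).add
      (hv'.integrable_smul_left_of_hasCompactSupport hdη (hasCompactSupport_dbar hc))

/-- The critical step. Absolute continuity of the integral of `|v|⁴` makes the coefficient `|v|²`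
small in `L²` on a small ball about `x`, and the self-improvement principle applies to `ηv` with `η`
supported in the closure of that ball. The terms with `β` and `dbar η` are of lower order and go
into the good term. -/
theorem exists_ball_setLIntegral_pairNorm_eight_lt_top (hα : ∀ j, ‖α j‖ₑ ≤ 1)
    (hv : ∀ j, Measurable (v j)) (h4 : ∫⁻ z, pairNorm v z ^ 4 < ∞)
    (hsol : ∀ j, WeakDbar (v j) (cubicRhs α β v j)) (x : ℂ) :
    ∃ r > 0, ∫⁻ z in Metric.ball x r, pairNorm v z ^ (8 : ℝ) < ∞ := by
  obtain ⟨ε, hε, hsmall⟩ := exists_smallness_rieszOp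
  obtain ⟨δ, hδ, hδε⟩ := exists_pos_setLIntegral_lt_of_measure_lt h4.ne hε.ne'
  obtain ⟨ρ, hρ, hρδ⟩ : ∃ ρ > 0, volume (Metric.ball x ρ) < δ := by
    have ht : Filter.Tendsto (fun r : ℝ => volume (Metric.ball x r)) (nhds 0) (nhds 0) := by
      have : Continuous fun r : ℝ => volume (Metric.ball x r) := by
        simp only [Complex.volume_ball]
        exact (ENNReal.continuous_mul_const (by simp)).comp
          (ENNReal.continuous_pow 2 |>.comp ENNReal.continuous_ofReal)
      simpa using this.tendsto 0
    obtain ⟨ρ, h1, h2⟩ := ((ht.eventually (gt_mem_nhds hδ)).filter_mono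
      nhdsWithin_le_nhds |>.and (self_mem_nhdsWithin (s := Set.Ioi (0 : ℝ)))).exists
    exact ⟨ρ, h2, h1⟩
  let b : ContDiffBump x := ⟨ρ / 2, ρ, by positivity, by linarith⟩
  let η : ℂ → ℂ := fun z => (b z : ℂ)
  have hη : ContDiff ℝ (⊤ : ℕ∞) η := Complex.ofRealCLM.contDiff.comp b.contDiff
  have hc : HasCompactSupport η :=
    b.hasCompactSupport.comp_left (g := Complex.ofReal) Complex.ofReal_zero
  have hηb : ∀ z, z ∉ Metric.ball x ρ → η z = 0 := by
    intro z hz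
    have : z ∉ Function.support b := by rwa [b.support_eq]
    simpa [η] using this
  have hdη := continuous_dbar (hη.of_le (by simp) : ContDiff ℝ 1 η)
  have hη1 : ∀ z, ‖η z‖ₑ ≤ 1 := by
    intro z
    rw [← ofReal_norm, ENNReal.ofReal_le_one]
    simp only [η, Complex.norm_real, Real.norm_eq_abs, abs_of_nonneg b.nonneg]
    exact b.le_one
  have hNm := measurable_pairNorm hv
  let W : ℂ → ℝ≥0∞ := (Metric.ball x ρ).indicator fun z => pairNorm v z ^ 2
  let U : ℂ → ℝ≥0∞ := fun z => ‖η z * v 0 z‖ₑ + ‖η z * v 1 z‖ₑ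
  -- A single product dominating both the `β` terms and the derivative of the cutoff; the
  -- superfluous cross terms are harmless.
  let g₀ : ℂ → ℝ≥0∞ := fun z => (‖β 0‖ₑ + ‖β 1‖ₑ + 1) * ((‖η z‖ₑ + ‖dbar η z‖ₑ) * pairNorm v z)
  have hWm : Measurable W := (hNm.pow_const 2).indicator measurableSet_ball
  have hηm := hη.continuous.measurable
  have hdηm := hdη.measurable
  have hUm : Measurable U := (hηm.mul (hv 0)).enorm.add (hηm.mul (hv 1)).enorm
  have hg₀m : Measurable g₀ := ((hηm.enorm.add hdηm.enorm).mul hNm).const_mul _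
  have hUN : ∀ z, U z ≤ pairNorm v z := by
    intro z
    simp only [U, pairNorm, enorm_mul]
    gcongr <;> exact mul_le_of_le_one_left' (hη1 z)
  have hpt : ∀ z, ‖η z * cubicRhs α β v 0 z + dbar η z * v 0 z‖ₑ +
      ‖η z * cubicRhs α β v 1 z + dbar η z * v 1 z‖ₑ ≤ g₀ z + W z * U z := by
    intro z
    have hW : ∀ j, pairNorm v z ^ 2 * ‖η z * v j z‖ₑ = W z * ‖η z * v j z‖ₑ := by
      intro j
      by_cases hz : z ∈ Metric.ball x ρ
      · simp only [W, Set.indicator_of_mem hz]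
      · simp [hηb z hz]
    have h0 := (enorm_add_le (η z * cubicRhs α β v 0 z) (dbar η z * v 0 z)).trans
      (add_le_add_left (enorm_mul_cubicRhs_le (β := β) hα v 0 (η z) z) _)
    have h1 := (enorm_add_le (η z * cubicRhs α β v 1 z) (dbar η z * v 1 z)).trans
      (add_le_add_left (enorm_mul_cubicRhs_le (β := β) hα v 1 (η z) z) _)
    refine (add_le_add h0 h1).trans ?_
    simp only [add_mul, hW, zero_add, show (1 : Fin 2) + 1 = 0 from rfl]
    have h2 : ∀ j, ‖η z * v j z‖ₑ ≤ ‖η z‖ₑ * pairNorm v z := fun j => by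
      rw [enorm_mul]; gcongr; exact enorm_le_pairNorm v j z
    calc _ ≤ W z * ‖η z * v 1 z‖ₑ + ‖β 0‖ₑ * (‖η z‖ₑ * pairNorm v z) + ‖dbar η z * v 0 z‖ₑ +
          (W z * ‖η z * v 0 z‖ₑ + ‖β 1‖ₑ * (‖η z‖ₑ * pairNorm v z) + ‖dbar η z * v 1 z‖ₑ) := by
          gcongr <;> exact h2 _
      _ = (‖β 0‖ₑ + ‖β 1‖ₑ) * (‖η z‖ₑ * pairNorm v z) + ‖dbar η z‖ₑ * pairNorm v z + W z * U z := by
          simp only [U, pairNorm, enorm_mul]; ring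
      _ ≤ g₀ z + W z * U z := by
          gcongr
          simp only [g₀]
          calc _ ≤ (‖β 0‖ₑ + ‖β 1‖ₑ) * (‖η z‖ₑ * pairNorm v z) + ‖dbar η z‖ₑ * pairNorm v z +
              ((‖β 0‖ₑ + ‖β 1‖ₑ) * (‖dbar η z‖ₑ * pairNorm v z) + ‖η z‖ₑ * pairNorm v z) :=
                le_self_add
            _ = _ := by ring
  have hU8 := hsmall W U (rieszOp g₀) hWm hUm (measurable_rieszOp hg₀m) ?_ ?_ ?_ ?_
  · refine ⟨ρ / 2, by positivity, ?_⟩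
    rw [← lintegral_indicator measurableSet_ball]
    refine (lintegral_mono fun z => ?_).trans_lt hU8
    by_cases hz : z ∈ Metric.ball x (ρ / 2)
    · have : η z = 1 := by
        simp only [η]
        rw [b.one_of_mem_closedBall (Metric.ball_subset_closedBall hz), Complex.ofReal_one]
      simp only [Set.indicator_of_mem hz, U, this, one_mul, pairNorm, ENNReal.rpow_ofNat]
      exact le_rfl
    · simp [hz]
  · have : ∀ z, W z ^ 2 = (Metric.ball x ρ).indicator (fun z => pairNorm v z ^ 4) z := by
      intro z
      by_cases hz : z ∈ Metric.ball x ρ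
      · simp only [W, Set.indicator_of_mem hz, ← pow_mul]
      · simp [W, hz]
    simp only [this]
    rw [lintegral_indicator measurableSet_ball]
    exact (hδε _ hρδ).le
  · exact (lintegral_mono fun z => pow_le_pow_left' (hUN z) 4).trans_lt h4
  -- The potential of `g₀` is in `L⁸` as soon as `g₀` is in `L^{8/5}`, which holds because `g₀` is
  -- dominated by a multiple of the `L⁴` function `pairNorm v` on a compact set.
  · obtain ⟨C, hC, hHLS⟩ := exists_lintegral_rieszOp_pow_le 4 (by norm_num)
    norm_num at hHLS
    refine (hHLS g₀ hg₀m).trans_lt (ENNReal.mul_lt_top hC.lt_top (ENNReal.pow_lt_top ?_))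
    obtain ⟨C', hC', hle⟩ := exists_enorm_le_of_continuous hdη (hasCompactSupport_dbar hc)
    refine lintegral_rpow_lt_top_of_le_indicator (K := tsupport η) (H := pairNorm v)
      (C := (‖β 0‖ₑ + ‖β 1‖ₑ + 1) * (1 + C')) (isClosed_tsupport η).measurableSet (by finiteness)
      (by norm_num) (fun z => ?_) (setLIntegral_pairNorm_lt_top (q := 4) (by norm_num)
      (by norm_num) hc.isCompact (setLIntegral_pairNorm_four_lt_top h4 _))
    by_cases hz : z ∈ tsupport η
    · simp only [g₀, Set.indicator_of_mem hz, ← mul_assoc]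
      gcongr
      · exact hη1 z
      · exact hle z
    · have h1 : dbar η z = 0 := by
        by_contra h
        exact hz (support_dbar_subset η h)
      simp [g₀, h1, image_eq_zero_of_notMem_tsupport hz]
  · filter_upwards [ae_enorm_cutoff_mul_le (β := β) hα hv h4 hsol hη hc 0,
      ae_enorm_cutoff_mul_le (β := β) hα hv h4 hsol hη hc 1] with w h0 h1
    refine (add_le_add h0 h1).trans ?_
    have hm : ∀ j, Measurable fun z => ‖η z * cubicRhs α β v j z + dbar η z * v j z‖ₑ := fun j =>
      ((hηm.mul (measurable_cubicRhs hv j)).add (hdηm.mul (hv j))).enorm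
    rw [← rieszOp_add (hm 0), ← rieszOp_add hg₀m]
    exact rieszOp_mono (.of_forall hpt) w

theorem setLIntegral_pairNorm_eight_lt_top (hα : ∀ j, ‖α j‖ₑ ≤ 1)
    (hv : ∀ j, Measurable (v j)) (h4 : ∫⁻ z, pairNorm v z ^ 4 < ∞)
    (hsol : ∀ j, WeakDbar (v j) (cubicRhs α β v j)) {K : Set ℂ} (hK : IsCompact K) :
    ∫⁻ z in K, pairNorm v z ^ (8 : ℝ) < ∞ := by
  refine hK.induction_on (p := fun s => ∫⁻ z in s, pairNorm v z ^ (8 : ℝ) < ∞) (by simp)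
    (fun _ _ hst ht => (lintegral_mono_set hst).trans_lt ht)
    (fun _ _ hs ht => (lintegral_union_le _ _ _).trans_lt (ENNReal.add_lt_top.2 ⟨hs, ht⟩))
    fun x _ => ?_
  obtain ⟨r, hr, h⟩ := exists_ball_setLIntegral_pairNorm_eight_lt_top hα hv h4 hsol x
  exact ⟨_, nhdsWithin_le_nhds (Metric.ball_mem_nhds x hr), h⟩

/-- Solutions in `L⁴` are locally bounded. -/
theorem exists_ae_norm_cutoff_mul_le (hα : ∀ j, ‖α j‖ₑ ≤ 1)
    (hv : ∀ j, Measurable (v j)) (h4 : ∫⁻ z, pairNorm v z ^ 4 < ∞)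
    (hsol : ∀ j, WeakDbar (v j) (cubicRhs α β v j))
    {η : ℂ → ℂ} (hη : ContDiff ℝ (⊤ : ℕ∞) η) (hc : HasCompactSupport η) (j : Fin 2) :
    ∃ M : ℝ, ∀ᵐ z, ‖η z * v j z‖ ≤ M := by
  -- The cube of a function in `L⁸` is in `L^{8/3}`, and `8/3 > 2` is what the uniform bound of the
  -- potential requires.
  have hpq : (8 / 3 : ℝ).HolderConjugate (8 / 5) := by
    rw [Real.holderConjugate_iff]; norm_num
  obtain ⟨C, hC, h⟩ := exists_rieszOp_le hpq (by norm_num)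
  have hdη := continuous_dbar (hη.of_le (by simp) : ContDiff ℝ 1 η)
  obtain ⟨C₁, hC₁, hle₁⟩ := exists_enorm_le_of_continuous hη.continuous hc
  obtain ⟨C₂, hC₂, hle₂⟩ := exists_enorm_le_of_continuous hdη (hasCompactSupport_dbar hc)
  let f : ℂ → ℝ≥0∞ := fun z => ‖η z * cubicRhs α β v j z + dbar η z * v j z‖ₑ
  have hfm : Measurable f := ((hη.continuous.measurable.mul (measurable_cubicRhs hv j)).add
    (hdη.measurable.mul (hv j))).enorm
  have hf : ∀ z, f z ≤ (C₁ * (1 + ‖β j‖ₑ) + C₂) *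
      (tsupport η).indicator (fun z => 1 + pairNorm v z ^ 3) z := by
    intro z
    by_cases hz : z ∈ tsupport η
    · rw [Set.indicator_of_mem hz, add_mul, mul_assoc]
      refine (enorm_add_le _ _).trans ?_
      rw [enorm_mul, enorm_mul]
      have hN : pairNorm v z ≤ 1 + pairNorm v z ^ 3 := by
        have := ENNReal.rpow_le_one_add_rpow (pairNorm v z) (p := 1) (q := (3 : ℕ))
          (by norm_num) (by norm_num)
        rwa [ENNReal.rpow_one, ENNReal.rpow_natCast] at this
      exact add_le_add (mul_le_mul' (hle₁ z) (enorm_cubicRhs_le hα v j z))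
        (mul_le_mul' (hle₂ z) ((enorm_le_pairNorm v j z).trans hN))
    · have h1 : dbar η z = 0 := by
        by_contra h
        exact hz (support_dbar_subset η h)
      simp [f, h1, image_eq_zero_of_notMem_tsupport hz]
  have h8 := setLIntegral_pairNorm_eight_lt_top hα hv h4 hsol hc.isCompact
  have hH : ∀ q : ℝ, 0 < q → q ≤ 8 / 3 →
      ∫⁻ z in tsupport η, (1 + pairNorm v z ^ 3) ^ q < ∞ := by
    intro q hq hq'
    refine (lintegral_mono (g := fun z => 2 ^ q * (1 + pairNorm v z ^ (8 : ℝ)))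
      fun z => ?_).trans_lt ?_
    · set N := pairNorm v z
      rcases le_total N 1 with hN | hN
      · calc (1 + N ^ 3) ^ q ≤ (1 + 1) ^ q :=
              ENNReal.rpow_le_rpow (add_le_add le_rfl (pow_le_one' hN 3)) hq.le
          _ = 2 ^ q * 1 := by rw [one_add_one_eq_two, mul_one]
          _ ≤ _ := mul_le_mul_right le_self_add _
      · calc (1 + N ^ 3) ^ q ≤ (N ^ 3 + N ^ 3) ^ q :=
              ENNReal.rpow_le_rpow (add_le_add (one_le_pow₀ hN) le_rfl) hq.le
          _ = 2 ^ q * N ^ (3 * q) := by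
              rw [← two_mul, ENNReal.mul_rpow_of_nonneg _ _ hq.le, ← ENNReal.rpow_natCast,
                ← ENNReal.rpow_mul]
              norm_num
          _ ≤ _ := mul_le_mul_right
              ((ENNReal.rpow_le_rpow_of_exponent_le hN (by linarith)).trans le_add_self) _
    · have h2 : (2 : ℝ≥0∞) ^ q ≠ ∞ := ENNReal.rpow_ne_top_of_nonneg hq.le (by simp)
      rw [lintegral_const_mul' _ _ h2]
      exact ENNReal.mul_lt_top h2.lt_top (setLIntegral_one_add_lt_top hc.isCompact h8)
  have hfq : ∀ q : ℝ, 0 < q → q ≤ 8 / 3 → ∫⁻ z, f z ^ q < ∞ := fun q hq hq' =>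
    lintegral_rpow_lt_top_of_le_indicator (isClosed_tsupport η).measurableSet (by finiteness) hq hf
      (hH q hq hq')
  let M : ℝ≥0∞ := (∫⁻ z, f z ^ (8 / 3 : ℝ)) ^ (1 / (8 / 3 : ℝ)) * C + ∫⁻ z, f z
  have hM : M ≠ ∞ := by
    refine ENNReal.add_ne_top.2 ⟨ENNReal.mul_ne_top (ENNReal.rpow_ne_top_of_nonneg (by norm_num)
      (hfq _ (by norm_num) le_rfl).ne) hC, ?_⟩
    simpa using (hfq 1 one_pos (by norm_num)).ne
  refine ⟨M.toReal, ?_⟩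
  filter_upwards [ae_enorm_cutoff_mul_le (β := β) hα hv h4 hsol hη hc j] with w hw
  have h1 := hw.trans (h f hfm w)
  rw [← toReal_enorm]
  exact ENNReal.toReal_mono hM h1

end Regularity

/-! ### Fourier transform: inversion, Plancherel, and the equation on the Fourier side. -/

theorem integral_fourier_mul_eq_flip {f g : ℂ → ℂ} (hf : Integrable f) (hg : Integrable g) :
    ∫ ξ, 𝓕 f ξ * g ξ = ∫ x, f x * 𝓕 g x := by
  simpa using! VectorFourier.integral_fourierIntegral_smul_eq_flip (L := innerₗ ℂ)
    Real.continuous_fourierChar continuous_inner hf hg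

theorem integral_fourierInv_mul_eq_flip {f g : ℂ → ℂ} (hf : Integrable f) (hg : Integrable g) :
    ∫ ξ, 𝓕⁻ f ξ * g ξ = ∫ x, f x * 𝓕⁻ g x := by
  have h1 := integral_fourier_mul_eq_flip hf hg.comp_neg
  rw [← integral_neg_eq_self] at h1
  simp only [neg_neg] at h1
  simp only [Real.fourierInv_eq_fourier_neg, h1]
  congr 1 with x
  rw [← Real.fourierInv_eq_fourier_neg, Real.fourierInv_eq_fourier_comp_neg]

theorem continuous_fourier {f : ℂ → ℂ} (hf : Integrable f) : Continuous (𝓕 f) :=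
  VectorFourier.fourierIntegral_continuous Real.continuous_fourierChar
    (L := innerₗ ℂ) continuous_inner hf

theorem continuous_fourierInv {f : ℂ → ℂ} (hf : Integrable f) : Continuous (𝓕⁻ f) := by
  rw [Real.fourierInv_eq_fourier_comp_neg]
  exact continuous_fourier hf.comp_neg

/-- Fourier inversion almost everywhere. -/
theorem ae_eq_fourierInv_fourier {f : ℂ → ℂ} (hf : Integrable f) (hf' : Integrable (𝓕 f)) :
    ∀ᵐ x, f x = 𝓕⁻ (𝓕 f) x := by
  refine ae_eq_of_integral_contDiff_smul_eq hf.locallyIntegrable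
    (continuous_fourierInv hf').locallyIntegrable fun g hg hgc => ?_
  have hc : HasCompactSupport (Complex.ofRealCLM ∘ g) := hgc.comp_left rfl
  have hs : ContDiff ℝ (⊤ : ℕ∞) (Complex.ofRealCLM ∘ g) := by fun_prop
  let G : SchwartzMap ℂ ℂ := hc.toSchwartzMap hs
  have hG : ∀ x, (g x : ℂ) = G x := fun x => rfl
  simp only [Complex.real_smul, hG]
  have h1 := integral_fourierInv_mul_eq_flip hf' G.integrable
  have h2 := integral_fourier_mul_eq_flip hf (𝓕⁻ G).integrable
  rw [SchwartzMap.fourierInv_coe] at h2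
  have h3 : 𝓕 (𝓕⁻ (G : ℂ → ℂ)) = G := by
    rw [← SchwartzMap.fourierInv_coe, ← SchwartzMap.fourier_coe,
      FourierTransform.fourier_fourierInv_eq]
  rw [h3] at h2
  simp only [mul_comm (G _)]
  rw [h1, h2]

/-- Plancherel's theorem for integrable and square integrable functions. -/
theorem lintegral_enorm_fourier_sq {f : ℂ → ℂ} (hf : Integrable f) (hf2 : MemLp f 2) :
    ∫⁻ ξ, ‖𝓕 f ξ‖ₑ ^ 2 = ∫⁻ x, ‖f x‖ₑ ^ 2 := by
  let F : Lp ℂ 2 (volume : Measure ℂ) := hf2.toLp f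
  -- The Fourier transform of the `L²` class and the Fourier integral agree when tested against
  -- smooth compactly supported functions; the isometry of the former then gives the claim for the
  -- latter.
  have hae : (𝓕 F : Lp ℂ 2 (volume : Measure ℂ)) =ᵐ[volume] 𝓕 f := by
    refine ae_eq_of_integral_contDiff_smul_eq
      ((Lp.memLp (𝓕 F)).locallyIntegrable (by norm_num))
      (continuous_fourier hf).locallyIntegrable fun g hg hgc => ?_
    have hc : HasCompactSupport (Complex.ofRealCLM ∘ g) := hgc.comp_left rfl
    have hs : ContDiff ℝ (⊤ : ℕ∞) (Complex.ofRealCLM ∘ g) := by fun_prop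
    let G : SchwartzMap ℂ ℂ := hc.toSchwartzMap hs
    have hG : ∀ x, (g x : ℂ) = G x := fun x => rfl
    simp only [Complex.real_smul, hG]
    have h1 := congrArg (fun T : TemperedDistribution ℂ ℂ => T G)
      (Lp.fourier_toTemperedDistribution_eq F)
    simp only [TemperedDistribution.fourier_apply, Lp.toTemperedDistribution_apply,
      smul_eq_mul] at h1
    rw [← h1]
    have h2 := integral_fourier_mul_eq_flip G.integrable hf
    rw [← h2, ← SchwartzMap.fourier_coe]
    refine integral_congr_ae ?_
    filter_upwards [hf2.coeFn_toLp] with x hx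
    rw [hx]
  have hn := Lp.norm_fourier_eq F
  have e : ∀ H : Lp ℂ 2 (volume : Measure ℂ), ∫⁻ x, ‖H x‖ₑ ^ 2 = ‖H‖ₑ ^ 2 := by
    intro H
    have := lintegral_rpow_enorm_eq_rpow_eLpNorm' (μ := (volume : Measure ℂ)) (f := H)
      (q := 2) two_pos
    simp only [ENNReal.rpow_ofNat] at this
    rw [this, Lp.enorm_def, eLpNorm_eq_eLpNorm' two_ne_zero ENNReal.ofNat_ne_top]
    simp
  calc ∫⁻ ξ, ‖𝓕 f ξ‖ₑ ^ 2 = ∫⁻ ξ, ‖(𝓕 F : Lp ℂ 2 (volume : Measure ℂ)) ξ‖ₑ ^ 2 :=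
        lintegral_congr_ae (hae.mono fun x hx => by simp only [hx])
    _ = ∫⁻ ξ, ‖F ξ‖ₑ ^ 2 := by
        rw [e, e, ← ofReal_norm, hn, ofReal_norm]
    _ = _ := lintegral_congr_ae (hf2.coeFn_toLp.mono fun x hx => by simp only [F, hx])

/-- The character `e` satisfies `dbar e = -2πiξ e`. Cut off away from the supports of `u` and `G`,
it is an admissible test function, and the weak equation becomes the identity. -/
theorem WeakDbar.mul_fourier_eq {u G : ℂ → ℂ} (h : WeakDbar u G)
    (huc : HasCompactSupport u) (hGc : HasCompactSupport G) (ξ : ℂ) :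
    2 * Real.pi * Complex.I * ξ * 𝓕 u ξ = 𝓕 G ξ := by
  let e : ℂ → ℂ := fun z => Complex.exp (↑(-2 * Real.pi * inner ℝ z ξ) * Complex.I)
  have he : ContDiff ℝ (⊤ : ℕ∞) e := by
    simp only [e]
    have h1 : ContDiff ℝ (⊤ : ℕ∞) fun z : ℂ => ((-2 * Real.pi * inner ℝ z ξ : ℝ) : ℂ) :=
      Complex.ofRealCLM.contDiff.comp
        (contDiff_const.mul (contDiff_id.inner ℝ contDiff_const))
    exact (h1.mul contDiff_const).cexp
  have hde : ∀ z, dbar e z = -(2 * Real.pi * Complex.I * ξ) * e z := by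
    intro z
    have h1 : HasFDerivAt e (e z • (((-2 * Real.pi) • (innerSL ℝ ξ)).smulRight Complex.I)) z := by
      have h2 : HasFDerivAt (fun z : ℂ => (↑(-2 * Real.pi * inner ℝ z ξ) : ℂ) * Complex.I)
          (((-2 * Real.pi) • (innerSL ℝ ξ)).smulRight Complex.I) z := by
        convert (((-2 * Real.pi) • (innerSL ℝ ξ)).smulRight Complex.I).hasFDerivAt using 1
        ext y
        simp [real_inner_comm]
      exact h2.cexp
    rw [dbar, h1.fderiv]
    simp [Complex.inner]
    linear_combination (-(2 * Real.pi * Complex.I * e z)) * Complex.re_add_im ξ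
  obtain ⟨η, hη, hηc, U, hU, hKU, h1⟩ :=
    exists_smooth_cutoff (huc.isCompact.union hGc.isCompact)
  have ht := h (fun z => η z * e z) (hη.mul he) hηc.mul_right
  have e1 : ∀ z, u z * dbar (fun z => η z * e z) z =
      -(2 * Real.pi * Complex.I * ξ) * (e z * u z) := by
    intro z
    by_cases hz : u z = 0
    · simp [hz]
    have hzU : z ∈ U := hKU (.inl (subset_tsupport u hz))
    have : (fun z => η z * e z) =ᶠ[nhds z] e := by
      filter_upwards [hU.mem_nhds hzU] with y hy
      simp [h1 y hy]
    rw [dbar, this.fderiv_eq, ← dbar, hde]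
    ring
  have e2 : ∀ z, G z * (η z * e z) = e z * G z := by
    intro z
    by_cases hz : G z = 0
    · simp [hz]
    rw [h1 z (hKU (.inr (subset_tsupport G hz))), one_mul, mul_comm]
  simp only [e1, e2] at ht
  rw [integral_const_mul, neg_mul, neg_inj] at ht
  rw [Real.fourier_eq', Real.fourier_eq']
  exact ht

theorem fourier_comp_add_right (f : ℂ → ℂ) (h ξ : ℂ) :
    𝓕 (fun z => f (z + h)) ξ =
      Complex.exp (↑(2 * Real.pi * inner ℝ h ξ) * Complex.I) * 𝓕 f ξ := by
  have := congrFun (VectorFourier.fourierIntegral_comp_add_right Real.fourierChar volume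
    (innerₗ ℂ) f h) ξ
  refine this.trans ?_
  rw [Circle.smul_def, Real.fourierChar_apply, smul_eq_mul]
  rfl

theorem fourier_conj (f : ℂ → ℂ) (ξ : ℂ) : 𝓕 (fun z => conj (f z)) ξ = conj (𝓕 f (-ξ)) := by
  rw [Real.fourier_eq', Real.fourier_eq', ← integral_conj]
  congr 1 with z
  simp only [smul_eq_mul, map_mul, ← Complex.exp_conj, Complex.conj_ofReal, Complex.conj_I,
    inner_neg_right, mul_neg, Complex.ofReal_neg, neg_mul, neg_neg]

/-- Write `f` as the inverse transform of `𝓕 f` and move that inverse transform onto `g` times the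
character, where it becomes a translate of `𝓕 g`. Only one of the two transforms has to be
integrable. -/
theorem fourier_mul_eq_integral {f g : ℂ → ℂ} (hf : Integrable f) (hf' : Integrable (𝓕 f))
    (hg : Integrable g) (ξ : ℂ) :
    𝓕 (fun z => f z * g z) ξ = ∫ y, 𝓕 f y * 𝓕 g (ξ - y) := by
  let e : ℂ → ℂ := fun z => Complex.exp (↑(-2 * Real.pi * inner ℝ z ξ) * Complex.I)
  have hge : Integrable fun z => e z * g z := by
    refine hg.bdd_mul (c := 1) (by simp only [e]; fun_prop) (.of_forall fun z => ?_)
    simp only [e]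
    rw [Complex.norm_exp_ofReal_mul_I]
  have h1 := integral_fourierInv_mul_eq_flip hf' hge
  rw [Real.fourier_eq']
  calc _ = ∫ z, 𝓕⁻ (𝓕 f) z * (e z * g z) := by
        refine integral_congr_ae ?_
        filter_upwards [ae_eq_fourierInv_fourier hf hf'] with z hz
        rw [← hz, smul_eq_mul]
        simp only [e]
        ring
    _ = _ := by
        rw [h1]
        congr 1 with y
        congr 1
        rw [Real.fourierInv_eq', Real.fourier_eq']
        congr 1 with z
        simp only [e, smul_eq_mul]
        rw [← mul_assoc, ← Complex.exp_add, inner_sub_right]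
        push_cast
        ring_nf

/-! ### Algebras of localised functions and the localised right-hand side. -/

/-- Essentially bounded measurable functions with compact support. -/
structure BddCompact (f : ℂ → ℂ) : Prop where
  measurable : Measurable f
  hasCompactSupport : HasCompactSupport f
  bdd : ∃ M : ℝ, ∀ᵐ z, ‖f z‖ ≤ M

/-- A class of functions closed under the operations in the right-hand side of the system. -/
structure ConjAlgebra (P : (ℂ → ℂ) → Prop) : Prop where
  add : ∀ {f g}, P f → P g → P fun z => f z + g z
  mul : ∀ {f g}, P f → P g → P fun z => f z * g z
  conjugate : ∀ {f}, P f → P fun z => conj (f z)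
  const_mul : ∀ (c : ℂ) {f}, P f → P fun z => c * f z

/-- If all localisations of a pair belong to a class closed under multiplication, so do the
localised right-hand sides of the system. -/
theorem ConjAlgebra.localized_rhs {P : (ℂ → ℂ) → Prop} (hP : ConjAlgebra P) {α β : Fin 2 → ℂ}
    {v : Fin 2 → ℂ → ℂ} (hv : ∀ η : ℂ → ℂ, ContDiff ℝ (⊤ : ℕ∞) η → HasCompactSupport η →
      ∀ j, P fun z => η z * v j z) {η : ℂ → ℂ} (hη : ContDiff ℝ (⊤ : ℕ∞) η)
    (hc : HasCompactSupport η) (j : Fin 2) :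
    P fun z => η z * cubicRhs α β v j z + dbar η z * v j z := by
  obtain ⟨η₁, hη₁, hc₁, U, -, hKU, h1⟩ := exists_smooth_cutoff hc.isCompact
  -- Each factor must carry a cutoff. In the cubic terms the other two factors get `η₁`, which is
  -- one on the support of `η`. In the linear term `η conj v = conj (conj η · v)`, so `conj η` is
  -- used as a cutoff as well.
  have hcη : HasCompactSupport fun z => conj (η z) := hc.comp_left (map_zero _)
  have hηconj : ContDiff ℝ (⊤ : ℕ∞) fun z => conj (η z) := Complex.conjCLE.contDiff.comp hη
  have t : ∀ k, P fun z => (η z * v k z) * (conj (η₁ z * v k z) * conj (η₁ z * v (j + 1) z)) :=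
    fun k => hP.mul (hv η hη hc k)
      (hP.mul (hP.conjugate (hv η₁ hη₁ hc₁ k)) (hP.conjugate (hv η₁ hη₁ hc₁ (j + 1))))
  have h := hP.add (hP.const_mul (α j) (hP.add (hP.add (t 0) (t 1))
    (hP.const_mul (β j) (hP.conjugate (hv _ hηconj hcη (j + 1))))))
    (hv _ (contDiff_dbar hη) (hasCompactSupport_dbar hc) j)
  convert h using 2 with z
  by_cases hz : η z = 0
  · simp [hz]
  · rw [h1 z (hKU (subset_tsupport η hz)), cubicRhs, one_mul, one_mul, one_mul, map_mul,
      Complex.conj_conj]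
    ring

theorem BddCompact.add {f g : ℂ → ℂ} (hf : BddCompact f) (hg : BddCompact g) :
    BddCompact fun z => f z + g z := by
  obtain ⟨M, hM⟩ := hf.bdd
  obtain ⟨N, hN⟩ := hg.bdd
  refine ⟨hf.measurable.add hg.measurable, hf.hasCompactSupport.add hg.hasCompactSupport,
    M + N, ?_⟩
  filter_upwards [hM, hN] with z h1 h2
  exact (norm_add_le _ _).trans (add_le_add h1 h2)

theorem BddCompact.mul {f g : ℂ → ℂ} (hf : BddCompact f) (hg : BddCompact g) :
    BddCompact fun z => f z * g z := by
  obtain ⟨M, hM⟩ := hf.bdd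
  obtain ⟨N, hN⟩ := hg.bdd
  refine ⟨hf.measurable.mul hg.measurable, hf.hasCompactSupport.mul_right, M * N, ?_⟩
  filter_upwards [hM, hN] with z h1 h2
  rw [norm_mul]
  exact mul_le_mul h1 h2 (norm_nonneg _) ((norm_nonneg _).trans h1)

theorem BddCompact.conjugate {f : ℂ → ℂ} (hf : BddCompact f) : BddCompact fun z => conj (f z) := by
  obtain ⟨M, hM⟩ := hf.bdd
  refine ⟨Complex.continuous_conj.measurable.comp hf.measurable,
    hf.hasCompactSupport.comp_left (map_zero _), M, ?_⟩
  filter_upwards [hM] with z h1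
  rwa [RCLike.norm_conj]

theorem BddCompact.const_mul (c : ℂ) {f : ℂ → ℂ} (hf : BddCompact f) :
    BddCompact fun z => c * f z := by
  obtain ⟨M, hM⟩ := hf.bdd
  refine ⟨hf.measurable.const_mul c, hf.hasCompactSupport.mul_left, ‖c‖ * M, ?_⟩
  filter_upwards [hM] with z h1
  rw [norm_mul]
  gcongr

theorem conjAlgebra_bddCompact : ConjAlgebra BddCompact :=
  ⟨.add, .mul, .conjugate, fun c _ h => h.const_mul c⟩

theorem BddCompact.memLp {f : ℂ → ℂ} (hf : BddCompact f) (p : ℝ≥0∞) : MemLp f p := by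
  obtain ⟨M, hM⟩ := hf.bdd
  have h1 : MemLp f p (volume.restrict (tsupport f)) := by
    have : IsFiniteMeasure (volume.restrict (tsupport f)) :=
      ⟨by simpa using hf.hasCompactSupport.isCompact.measure_lt_top⟩
    exact MemLp.of_bound hf.measurable.aestronglyMeasurable M (ae_restrict_of_ae hM)
  have h2 := (memLp_indicator_iff_restrict (isClosed_tsupport f).measurableSet).2 h1
  rwa [Set.indicator_eq_self.2 (subset_tsupport f)] at h2

theorem BddCompact.integrable {f : ℂ → ℂ} (hf : BddCompact f) : Integrable f :=
  memLp_one_iff_integrable.1 (hf.memLp 1)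

theorem lintegral_enorm_sq_lt_top {f : ℂ → ℂ} (hf : MemLp f 2) : ∫⁻ z, ‖f z‖ₑ ^ 2 < ∞ := by
  have := (eLpNorm_lt_top_iff_lintegral_rpow_enorm_lt_top two_ne_zero ENNReal.ofNat_ne_top).1 hf.2
  simpa using this

/-! ### First gain: one derivative in `L²`. -/

/-- Bounded compactly supported functions whose translates are Lipschitz in `L²`. -/
def LipschitzL2 (f : ℂ → ℂ) : Prop :=
  BddCompact f ∧ ∃ C : ℝ≥0∞, C ≠ ∞ ∧ ∀ h, ∫⁻ z, ‖f (z + h) - f z‖ₑ ^ 2 ≤ C * ‖h‖ₑ ^ 2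

theorem lintegral_enorm_sq_le_of_le {F f g : ℂ → ℂ} {A B C D X : ℝ≥0∞}
    (hF : ∀ᵐ z, ‖F z‖ₑ ≤ A * ‖f z‖ₑ + B * ‖g z‖ₑ) (hA : A ≠ ∞) (hB : B ≠ ∞)
    (hfm : Measurable f) (hf : ∫⁻ z, ‖f z‖ₑ ^ 2 ≤ C * X) (hg : ∫⁻ z, ‖g z‖ₑ ^ 2 ≤ D * X) :
    ∫⁻ z, ‖F z‖ₑ ^ 2 ≤ (2 * A ^ 2 * C + 2 * B ^ 2 * D) * X := by
  calc _ ≤ ∫⁻ z, (2 * A ^ 2 * ‖f z‖ₑ ^ 2 + 2 * B ^ 2 * ‖g z‖ₑ ^ 2) := by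
        refine lintegral_mono_ae (hF.mono fun z hz => ?_)
        refine (pow_le_pow_left' hz 2).trans ?_
        have h := ENNReal.rpow_add_le_mul_rpow_add_rpow (A * ‖f z‖ₑ) (B * ‖g z‖ₑ)
          (p := 2) one_le_two
        norm_num at h
        refine h.trans (le_of_eq ?_)
        ring
    _ = 2 * A ^ 2 * (∫⁻ z, ‖f z‖ₑ ^ 2) + 2 * B ^ 2 * ∫⁻ z, ‖g z‖ₑ ^ 2 := by
        rw [lintegral_add_left (by fun_prop), lintegral_const_mul' _ _ (by finiteness),
          lintegral_const_mul' _ _ (by finiteness)]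
    _ ≤ 2 * A ^ 2 * (C * X) + 2 * B ^ 2 * (D * X) := by gcongr
    _ = _ := by ring

/-- Closure under products is the Leibniz rule for differences; each difference is paired with an
essentially bounded factor, which is why boundedness is part of the class. -/
theorem conjAlgebra_lipschitzL2 : ConjAlgebra LipschitzL2 where
  add := by
    rintro f g ⟨hf, C, hC, hCf⟩ ⟨hg, D, hD, hDg⟩
    refine ⟨hf.add hg, 2 * 1 ^ 2 * C + 2 * 1 ^ 2 * D, by finiteness, fun h => ?_⟩
    have hfm := hf.measurable
    refine lintegral_enorm_sq_le_of_le (f := fun z => f (z + h) - f z)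
      (g := fun z => g (z + h) - g z) (.of_forall fun z => ?_) ENNReal.one_ne_top
      ENNReal.one_ne_top (by fun_prop) (hCf h) (hDg h)
    rw [one_mul, one_mul]
    refine le_trans (le_of_eq ?_) (enorm_add_le _ _)
    congr 1
    ring
  mul := by
    rintro f g ⟨hf, C, hC, hCf⟩ ⟨hg, D, hD, hDg⟩
    obtain ⟨M, hM⟩ := hf.bdd
    obtain ⟨N, hN⟩ := hg.bdd
    refine ⟨hf.mul hg, 2 * ENNReal.ofReal N ^ 2 * C + 2 * ENNReal.ofReal M ^ 2 * D,
      by finiteness, fun h => ?_⟩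
    have hfm := hf.measurable
    have hN' := (measurePreserving_add_right (volume : Measure ℂ) h).quasiMeasurePreserving.ae hN
    refine lintegral_enorm_sq_le_of_le (f := fun z => f (z + h) - f z)
      (g := fun z => g (z + h) - g z) ?_ ENNReal.ofReal_ne_top
      ENNReal.ofReal_ne_top (by fun_prop) (hCf h) (hDg h)
    filter_upwards [hM, hN'] with z h1 h2
    rw [show f (z + h) * g (z + h) - f z * g z =
      g (z + h) * (f (z + h) - f z) + f z * (g (z + h) - g z) by ring]
    refine (enorm_add_le _ _).trans ?_
    rw [enorm_mul, enorm_mul, ← ofReal_norm (g (z + h)), ← ofReal_norm (f z)]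
    gcongr
  conjugate := by
    rintro f ⟨hf, C, hC, hCf⟩
    refine ⟨hf.conjugate, C, hC, fun h => (lintegral_mono fun z => le_of_eq ?_).trans (hCf h)⟩
    rw [← map_sub, ← ofReal_norm, RCLike.norm_conj, ofReal_norm]
  const_mul := by
    rintro c f ⟨hf, C, hC, hCf⟩
    refine ⟨hf.const_mul c, ‖c‖ₑ ^ 2 * C, by finiteness, fun h => ?_⟩
    simp only [← mul_sub, enorm_mul, mul_pow]
    rw [lintegral_const_mul' _ _ (by finiteness), mul_assoc]
    gcongr
    exact hCf h

theorem norm_two_pi_I : ‖(2 * Real.pi * Complex.I : ℂ)‖ₑ = ENNReal.ofReal (2 * Real.pi) := by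
  rw [← ofReal_norm]
  simp [abs_of_pos Real.pi_pos]

theorem enorm_fourier_comp_add_sub (f : ℂ → ℂ) (hf : Integrable f) (h ξ : ℂ) :
    ‖𝓕 (fun z => f (z + h) - f z) ξ‖ₑ =
      ‖Complex.exp (↑(2 * Real.pi * inner ℝ h ξ) * Complex.I) - 1‖ₑ * ‖𝓕 f ξ‖ₑ := by
  have h1 : 𝓕 (fun z => f (z + h) - f z) ξ = 𝓕 (fun z => f (z + h)) ξ - 𝓕 f ξ := by
    rw [Real.fourier_eq, Real.fourier_eq, Real.fourier_eq, ← integral_sub]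
    · simp only [smul_sub]
    · exact (Real.fourierIntegral_convergent_iff ξ).2 (hf.comp_add_right h)
    · exact (Real.fourierIntegral_convergent_iff ξ).2 hf
  rw [h1, fourier_comp_add_right, ← enorm_mul]
  congr 1
  ring

theorem lintegral_enorm_translate_sub_sq {f : ℂ → ℂ} (hf : BddCompact f) (h : ℂ) :
    ∫⁻ z, ‖f (z + h) - f z‖ₑ ^ 2 = ∫⁻ ξ,
      (‖Complex.exp (↑(2 * Real.pi * inner ℝ h ξ) * Complex.I) - 1‖ₑ * ‖𝓕 f ξ‖ₑ) ^ 2 := by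
  have h1 : Integrable fun z => f (z + h) - f z :=
    (hf.integrable.comp_add_right h).sub hf.integrable
  have h2 : MemLp (fun z => f (z + h) - f z) 2 :=
    ((hf.memLp 2).comp_measurePreserving (measurePreserving_add_right volume h)).sub (hf.memLp 2)
  rw [← lintegral_enorm_fourier_sq h1 h2]
  simp only [enorm_fourier_comp_add_sub f hf.integrable]

theorem WeakDbar.enorm_fourier_eq {u G : ℂ → ℂ} (h : WeakDbar u G) (huc : HasCompactSupport u)
    (hGc : HasCompactSupport G) (ξ : ℂ) :
    ENNReal.ofReal (2 * Real.pi) * ‖ξ‖ₑ * ‖𝓕 u ξ‖ₑ = ‖𝓕 G ξ‖ₑ := by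
  rw [← h.mul_fourier_eq huc hGc, enorm_mul, enorm_mul, norm_two_pi_I]

/-- By Plancherel, a translation by `a` multiplies `û` by a phase, and `|e^{2πi⟨a,ξ⟩} - 1| |û| ≤ 2π
|a| |ξ| |û| = |a| |Ĝ|`. The Lipschitz constant is the `L²` norm of `G`. -/
theorem WeakDbar.lipschitzL2 {u G : ℂ → ℂ} (h : WeakDbar u G) (hu : BddCompact u)
    (hG : BddCompact G) : LipschitzL2 u := by
  refine ⟨hu, ∫⁻ z, ‖G z‖ₑ ^ 2, (lintegral_enorm_sq_lt_top (hG.memLp 2)).ne, fun a => ?_⟩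
  rw [lintegral_enorm_translate_sub_sq hu, ← lintegral_enorm_fourier_sq hG.integrable (hG.memLp 2),
    ← lintegral_mul_const' _ _ (by finiteness)]
  refine lintegral_mono fun ξ => ?_
  rw [← mul_pow]
  refine pow_le_pow_left' ?_ 2
  rw [← h.enorm_fourier_eq hu.hasCompactSupport hG.hasCompactSupport,
    mul_right_comm (ENNReal.ofReal (2 * Real.pi) * ‖ξ‖ₑ)]
  refine mul_le_mul_left ?_ _
  have h1 := Real.norm_exp_I_mul_ofReal_sub_one_le (x := 2 * Real.pi * inner ℝ a ξ)
  rw [mul_comm Complex.I] at h1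
  rw [← ofReal_norm, ← ofReal_norm, ← ofReal_norm, ← ENNReal.ofReal_mul (by positivity),
    ← ENNReal.ofReal_mul (by positivity)]
  refine ENNReal.ofReal_le_ofReal (h1.trans ?_)
  rw [norm_mul, Real.norm_of_nonneg (by positivity : 0 ≤ 2 * Real.pi)]
  have h2 : ‖(inner ℝ a ξ : ℝ)‖ ≤ ‖a‖ * ‖ξ‖ := norm_inner_le_norm a ξ
  calc _ ≤ 2 * Real.pi * (‖a‖ * ‖ξ‖) := by gcongr
    _ = _ := by ring

/-- Fatou's lemma for the difference quotients with steps `1/(n+1)`, whose Fourier multipliers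
converge pointwise to `2πi⟨e,ξ⟩`. The directions `1` and `I` together then control `|ξ| 𝓕 f`. -/
theorem lintegral_fourier_directional_le {f : ℂ → ℂ} (hf : BddCompact f) {C : ℝ≥0∞}
    (hC : ∀ h, ∫⁻ z, ‖f (z + h) - f z‖ₑ ^ 2 ≤ C * ‖h‖ₑ ^ 2) {e : ℂ} (he : ‖e‖ₑ = 1) :
    ∫⁻ ξ, (‖(2 * Real.pi * inner ℝ e ξ : ℝ)‖ₑ * ‖𝓕 f ξ‖ₑ) ^ 2 ≤ C := by
  let t : ℕ → ℝ := fun n => 1 / ((n : ℝ) + 1)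
  have ht : ∀ n, 0 < t n := fun n => by positivity
  have htlim : Filter.Tendsto t Filter.atTop (nhds 0) := tendsto_one_div_add_atTop_nhds_zero_nat
  let D : ℕ → ℂ → ℂ := fun n ξ => ((t n : ℝ) : ℂ)⁻¹ *
    (Complex.exp (↑(2 * Real.pi * inner ℝ (t n • e) ξ) * Complex.I) - 1)
  have hD : ∀ ξ, Filter.Tendsto (fun n => D n ξ) Filter.atTop
      (nhds (((2 * Real.pi * inner ℝ e ξ : ℝ) : ℂ) * Complex.I)) := by
    intro ξ
    have h1 : HasDerivAt (fun s : ℝ => Complex.exp (↑(2 * Real.pi * (s * inner ℝ e ξ)) * Complex.I))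
        (((2 * Real.pi * inner ℝ e ξ : ℝ) : ℂ) * Complex.I) 0 := by
      have h2 : HasDerivAt (fun s : ℝ => (↑(2 * Real.pi * (s * inner ℝ e ξ)) : ℂ) * Complex.I)
          (((2 * Real.pi * inner ℝ e ξ : ℝ) : ℂ) * Complex.I) 0 := by
        have h3 : HasDerivAt (fun s : ℝ => 2 * Real.pi * (s * inner ℝ e ξ))
            (2 * Real.pi * inner ℝ e ξ) 0 := by
          simpa using ((hasDerivAt_id (0 : ℝ)).mul_const (inner ℝ e ξ)).const_mul (2 * Real.pi)
        exact h3.ofReal_comp.mul_const _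
      simpa using h2.cexp
    have h2 := h1.tendsto_slope_zero
    have h3 : Filter.Tendsto t Filter.atTop (nhdsWithin 0 {0}ᶜ) :=
      tendsto_nhdsWithin_iff.2 ⟨htlim, .of_forall fun n => (ht n).ne'⟩
    refine (h2.comp h3).congr fun n => ?_
    simp only [D, Function.comp, zero_add, zero_mul, mul_zero, Complex.ofReal_zero, Complex.exp_zero,
      real_inner_smul_left]
    rw [Complex.real_smul, Complex.ofReal_inv]
  have hbound : ∀ n, ∫⁻ ξ, (‖D n ξ‖ₑ * ‖𝓕 f ξ‖ₑ) ^ 2 ≤ C := by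
    intro n
    have h1 := hC (t n • e)
    have ht0 : ‖((t n : ℝ) : ℂ)‖ₑ ≠ 0 := by simp [(ht n).ne']
    rw [lintegral_enorm_translate_sub_sq hf, enorm_smul, he, mul_one] at h1
    have h2 : ∀ ξ, (‖D n ξ‖ₑ * ‖𝓕 f ξ‖ₑ) ^ 2 = (‖((t n : ℝ) : ℂ)‖ₑ ^ 2)⁻¹ *
        (‖Complex.exp (↑(2 * Real.pi * inner ℝ (t n • e) ξ) * Complex.I) - 1‖ₑ *
          ‖𝓕 f ξ‖ₑ) ^ 2 := by
      intro ξ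
      simp only [D]
      rw [enorm_mul, enorm_inv (by exact_mod_cast (ht n).ne'), ENNReal.inv_pow]
      ring
    simp only [h2]
    rw [lintegral_const_mul' _ _ (by simp [(ht n).ne'])]
    refine (mul_le_mul_right h1 _).trans (le_of_eq ?_)
    have h3 : ‖t n‖ₑ = ‖((t n : ℝ) : ℂ)‖ₑ := by
      rw [← ofReal_norm, ← ofReal_norm, Complex.norm_real]
    rw [h3, mul_left_comm, ENNReal.inv_mul_cancel (pow_ne_zero _ ht0) (by simp), mul_one]
  have hcont := continuous_fourier hf.integrable
  calc ∫⁻ ξ, (‖(2 * Real.pi * inner ℝ e ξ : ℝ)‖ₑ * ‖𝓕 f ξ‖ₑ) ^ 2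
    _ = ∫⁻ ξ, Filter.liminf (fun n => (‖D n ξ‖ₑ * ‖𝓕 f ξ‖ₑ) ^ 2) Filter.atTop := by
        refine lintegral_congr fun ξ => ?_
        have h1 : Filter.Tendsto (fun n => (‖D n ξ‖ₑ * ‖𝓕 f ξ‖ₑ) ^ 2) Filter.atTop
            (nhds ((‖((2 * Real.pi * inner ℝ e ξ : ℝ) : ℂ) * Complex.I‖ₑ * ‖𝓕 f ξ‖ₑ) ^ 2)) :=
          ((ENNReal.continuous_pow 2).tendsto _).comp
            (ENNReal.Tendsto.mul_const ((hD ξ).enorm) (.inr enorm_ne_top))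
        rw [h1.liminf_eq]
        congr 2
        have h2 : ∀ x : ℝ, ‖(x : ℂ) * Complex.I‖ = ‖x‖ := fun x => by
          rw [norm_mul, Complex.norm_I, mul_one, Complex.norm_real]
        rw [← ofReal_norm, ← ofReal_norm, h2]
    _ ≤ Filter.liminf (fun n => ∫⁻ ξ, (‖D n ξ‖ₑ * ‖𝓕 f ξ‖ₑ) ^ 2) Filter.atTop := by
        refine lintegral_liminf_le fun n => ?_
        have h1 : Continuous (D n) := by simp only [D]; fun_prop
        fun_prop
    _ ≤ C := (Filter.liminf_le_liminf (.of_forall hbound)).trans (by simp)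

theorem LipschitzL2.lintegral_enorm_mul_fourier_sq_lt_top {f : ℂ → ℂ} (hf : LipschitzL2 f) :
    ∫⁻ ξ, (‖ξ‖ₑ * ‖𝓕 f ξ‖ₑ) ^ 2 < ∞ := by
  obtain ⟨hb, C, hC, h⟩ := hf
  have h1 := lintegral_fourier_directional_le hb h (e := 1) (by simp)
  have h2 := lintegral_fourier_directional_le hb h (e := Complex.I) (by
    rw [← ofReal_norm, Complex.norm_I, ENNReal.ofReal_one])
  have hcont := continuous_fourier hb.integrable
  refine lt_of_le_of_lt (b := C + C) ?_ (by finiteness)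
  refine le_trans ?_ (add_le_add h1 h2)
  rw [← lintegral_add_left (by fun_prop)]
  refine lintegral_mono fun ξ => ?_
  simp only [mul_pow]
  rw [← add_mul]
  refine mul_le_mul_left ?_ _
  have e : ∀ x : ℝ, ‖x‖ₑ ^ 2 = ENNReal.ofReal (x ^ 2) := fun x => by
    rw [← ofReal_norm, ← ENNReal.ofReal_pow (norm_nonneg _), Real.norm_eq_abs, sq_abs]
  rw [← ofReal_norm, ← ENNReal.ofReal_pow (norm_nonneg _), e, e,
    ← ENNReal.ofReal_add (by positivity) (by positivity)]
  refine ENNReal.ofReal_le_ofReal ?_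
  have h3 : inner ℝ (1 : ℂ) ξ = ξ.re := by simp [Complex.inner]
  have h4 : inner ℝ Complex.I ξ = ξ.im := by simp [Complex.inner]
  rw [h3, h4, ← Complex.normSq_eq_norm_sq, Complex.normSq_apply]
  have h5 : (1 : ℝ) ≤ (2 * Real.pi) ^ 2 := one_le_pow₀ (by linarith [Real.pi_gt_three])
  nlinarith [sq_nonneg ξ.re, sq_nonneg ξ.im]

/-! ### Wiener classes and the bootstrap to all orders. -/

/-- Bounded compactly supported functions whose Fourier transform is integrable against the weight
`(1 + |ξ|) ^ s`. -/
def WienerClass (s : ℕ) (f : ℂ → ℂ) : Prop :=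
  BddCompact f ∧ Integrable fun ξ => (1 + ‖ξ‖) ^ s * ‖𝓕 f ξ‖

/-- From `2π |ξ| |û| = |Ĝ|` and `|ξ| Ĝ` in `L²`, the function `|ξ|² û` is in `L²`, as is `û`. So `(1
+ |ξ|)² û` is in `L²`, and `(1 + |ξ|)⁻²` is in `L²` of the plane. -/
theorem WeakDbar.wienerClass_zero {u G : ℂ → ℂ} (h : WeakDbar u G) (hu : BddCompact u)
    (hG : LipschitzL2 G) : WienerClass 0 u := by
  refine ⟨hu, ?_⟩
  have hcont := continuous_fourier hu.integrable
  simp only [pow_zero, one_mul]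
  refine ⟨by fun_prop, ?_⟩
  rw [hasFiniteIntegral_iff_enorm]
  simp only [enorm_norm]
  have h1 := hG.lintegral_enorm_mul_fourier_sq_lt_top
  have h2 : ∫⁻ ξ, (‖ξ‖ₑ ^ 2 * ‖𝓕 u ξ‖ₑ) ^ 2 < ∞ := by
    refine lt_of_le_of_lt (lintegral_mono fun ξ => ?_) h1
    rw [← h.enorm_fourier_eq hu.hasCompactSupport hG.1.hasCompactSupport]
    refine pow_le_pow_left' ?_ 2
    have h3 : (1 : ℝ≥0∞) ≤ ENNReal.ofReal (2 * Real.pi) :=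
      ENNReal.one_le_ofReal.2 (by linarith [Real.pi_gt_three])
    calc _ = 1 * (‖ξ‖ₑ ^ 2 * ‖𝓕 u ξ‖ₑ) := (one_mul _).symm
      _ ≤ ENNReal.ofReal (2 * Real.pi) * (‖ξ‖ₑ ^ 2 * ‖𝓕 u ξ‖ₑ) := by gcongr
      _ = _ := by ring
  have h0 : ∫⁻ ξ, ‖𝓕 u ξ‖ₑ ^ 2 < ∞ := by
    rw [lintegral_enorm_fourier_sq hu.integrable (hu.memLp 2)]
    exact lintegral_enorm_sq_lt_top (hu.memLp 2)
  have hw : ∫⁻ ξ : ℂ, ENNReal.ofReal ((1 + ‖ξ‖) ^ (-(4 : ℝ))) < ∞ :=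
    (integrable_one_add_norm (E := ℂ) (μ := volume) (r := 4)
      (by rw [Complex.finrank_real_complex]; norm_num)).lintegral_lt_top
  -- Cauchy–Schwarz in pointwise form: `a ≤ w⁻¹ + w a²` with `w = (1 + r)⁴ ≤ 8 (1 + r⁴)`.
  refine lt_of_le_of_lt (lintegral_mono (g := fun ξ => ENNReal.ofReal ((1 + ‖ξ‖) ^ (-(4 : ℝ))) +
    (8 * ‖𝓕 u ξ‖ₑ ^ 2 + 8 * (‖ξ‖ₑ ^ 2 * ‖𝓕 u ξ‖ₑ) ^ 2)) fun ξ => ?_) ?_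
  · set a := ‖𝓕 u ξ‖ with ha
    have e1 : ‖𝓕 u ξ‖ₑ = ENNReal.ofReal a := (ofReal_norm _).symm
    have e2 : ‖ξ‖ₑ = ENNReal.ofReal ‖ξ‖ := (ofReal_norm _).symm
    have ha0 : 0 ≤ a := norm_nonneg _
    have e8 : (8 : ℝ≥0∞) = ENNReal.ofReal 8 := by norm_num
    beta_reduce
    rw [e1, e2, e8, ← ENNReal.ofReal_pow (by positivity), ← ENNReal.ofReal_pow (by positivity),
      ← ENNReal.ofReal_mul (by positivity), ← ENNReal.ofReal_mul (by positivity),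
      ← ENNReal.ofReal_pow (by positivity), ← ENNReal.ofReal_mul (by positivity),
      ← ENNReal.ofReal_add (by positivity) (by positivity),
      ← ENNReal.ofReal_add (by positivity) (by positivity)]
    refine ENNReal.ofReal_le_ofReal ?_
    have hw0 : 0 < 1 + ‖ξ‖ := by positivity
    rw [Real.rpow_neg hw0.le, show (4 : ℝ) = (4 : ℕ) by norm_num, Real.rpow_natCast]
    set r := ‖ξ‖
    have hr0 : 0 ≤ r := norm_nonneg _
    have h5 : (1 + r) ^ 4 ≤ 8 * (1 + r ^ 4) := by
      nlinarith [sq_nonneg (1 - r), sq_nonneg (1 - r ^ 2), sq_nonneg (r * (1 - r)),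
        mul_nonneg hr0 (sq_nonneg (1 - r))]
    have h6 : a ≤ ((1 + r) ^ 4)⁻¹ + (1 + r) ^ 4 * a ^ 2 := by
      have hp : 0 < (1 + r) ^ 4 := by positivity
      have h7 : ((1 + r) ^ 4)⁻¹ * ((1 + r) ^ 4) = 1 := inv_mul_cancel₀ hp.ne'
      have hp' : 0 < ((1 + r) ^ 4)⁻¹ := by positivity
      nlinarith [mul_nonneg hp.le (sq_nonneg (a - ((1 + r) ^ 4)⁻¹))]
    nlinarith [mul_le_mul_of_nonneg_right h5 (sq_nonneg a)]
  · rw [lintegral_add_right _ (by fun_prop), lintegral_add_right _ (by fun_prop),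
      lintegral_const_mul' _ _ (by simp), lintegral_const_mul' _ _ (by simp)]
    finiteness

theorem WienerClass.of_le {s t : ℕ} (hst : s ≤ t) {f : ℂ → ℂ} (hf : WienerClass t f) :
    WienerClass s f := by
  refine ⟨hf.1, hf.2.mono ?_ (.of_forall fun ξ => ?_)⟩
  · have := continuous_fourier hf.1.integrable
    fun_prop
  · rw [Real.norm_of_nonneg (by positivity), Real.norm_of_nonneg (by positivity)]
    gcongr
    linarith [norm_nonneg ξ]

/-- The extra factor `1 + |ξ|` splits: the `1` is covered by the assumption on `u`, and `|ξ| |û| =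
|Ĝ|/(2π)` by the assumption on `G`. -/
theorem WeakDbar.wienerClass_succ {u G : ℂ → ℂ} (h : WeakDbar u G) {s : ℕ} (hu : WienerClass s u)
    (hG : WienerClass s G) : WienerClass (s + 1) u := by
  refine ⟨hu.1, (hu.2.add (hG.2.const_mul (2 * Real.pi)⁻¹)).congr (.of_forall fun ξ => ?_)⟩
  have h1 := congrArg norm (h.mul_fourier_eq hu.1.hasCompactSupport hG.1.hasCompactSupport ξ)
  have h2 : ‖(2 * Real.pi * Complex.I : ℂ)‖ = 2 * Real.pi := by simp [abs_of_pos Real.pi_pos]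
  rw [norm_mul, norm_mul, h2] at h1
  simp only [Pi.add_apply]
  rw [← h1]
  field_simp
  ring

theorem fourier_fun_add {f g : ℂ → ℂ} (hf : Integrable f) (hg : Integrable g) (ξ : ℂ) :
    𝓕 (fun z => f z + g z) ξ = 𝓕 f ξ + 𝓕 g ξ := by
  rw [Real.fourier_eq, Real.fourier_eq, Real.fourier_eq, ← integral_add]
  · simp only [smul_add]
  · exact (Real.fourierIntegral_convergent_iff ξ).2 hf
  · exact (Real.fourierIntegral_convergent_iff ξ).2 hg

theorem fourier_const_mul (c : ℂ) (f : ℂ → ℂ) (ξ : ℂ) :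
    𝓕 (fun z => c * f z) ξ = c * 𝓕 f ξ := by
  rw [Real.fourier_eq', Real.fourier_eq', ← integral_const_mul]
  congr 1 with z
  simp only [smul_eq_mul]
  ring

theorem WienerClass.integrable_fourier {s : ℕ} {f : ℂ → ℂ} (hf : WienerClass s f) :
    Integrable (𝓕 f) := by
  have := (hf.of_le (Nat.zero_le s)).2
  simp only [pow_zero, one_mul] at this
  exact (integrable_norm_iff (continuous_fourier hf.1.integrable).aestronglyMeasurable).1 this

/-- For products: the transform of `fg` is a convolution, the weight is submultiplicative, `1 + |ξ|
≤ (1 + |y|)(1 + |ξ - y|)`, and convolution preserves integrability. -/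
theorem conjAlgebra_wienerClass (s : ℕ) : ConjAlgebra (WienerClass s) where
  add := by
    intro f g hf hg
    have hc := continuous_fourier (hf.1.add hg.1).integrable
    refine ⟨hf.1.add hg.1, (hf.2.add hg.2).mono (by fun_prop) (.of_forall fun ξ => ?_)⟩
    rw [fourier_fun_add hf.1.integrable hg.1.integrable, Real.norm_of_nonneg (by positivity)]
    simp only [Pi.add_apply]
    rw [Real.norm_of_nonneg (by positivity), ← mul_add]
    gcongr
    exact norm_add_le _ _
  mul := by
    intro f g hf hg
    have hc := continuous_fourier (hf.1.mul hg.1).integrable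
    refine ⟨hf.1.mul hg.1, (hf.2.integrable_convolution (ContinuousLinearMap.mul ℝ ℝ) hg.2).mono
      (by fun_prop) ?_⟩
    filter_upwards [hf.2.ae_convolution_exists (ContinuousLinearMap.mul ℝ ℝ) hg.2] with ξ hξ
    rw [fourier_mul_eq_integral hf.1.integrable hf.integrable_fourier hg.1.integrable,
      Real.norm_of_nonneg (by positivity), convolution_def]
    refine le_trans ?_ (le_abs_self _)
    calc _ ≤ (1 + ‖ξ‖) ^ s * ∫ y, ‖𝓕 f y * 𝓕 g (ξ - y)‖ := by
          gcongr; exact norm_integral_le_integral_norm _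
      _ = ∫ y, (1 + ‖ξ‖) ^ s * ‖𝓕 f y * 𝓕 g (ξ - y)‖ := (integral_const_mul _ _).symm
      _ ≤ _ := by
          refine integral_mono_of_nonneg (.of_forall fun y => by positivity) hξ.integrable
            (.of_forall fun y => ?_)
          simp only [ContinuousLinearMap.mul_apply', norm_mul]
          have h1 : 1 + ‖ξ‖ ≤ (1 + ‖y‖) * (1 + ‖ξ - y‖) := by
            have h2 : ‖ξ‖ ≤ ‖y‖ + ‖ξ - y‖ := by simpa using norm_add_le y (ξ - y)
            nlinarith [mul_nonneg (norm_nonneg y) (norm_nonneg (ξ - y))]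
          calc (1 + ‖ξ‖) ^ s * (‖𝓕 f y‖ * ‖𝓕 g (ξ - y)‖) ≤
              ((1 + ‖y‖) * (1 + ‖ξ - y‖)) ^ s * (‖𝓕 f y‖ * ‖𝓕 g (ξ - y)‖) := by gcongr
            _ = _ := by rw [mul_pow]; ring
  conjugate := by
    intro f hf
    refine ⟨hf.1.conjugate, hf.2.comp_neg.congr (.of_forall fun ξ => ?_)⟩
    simp only [fourier_conj, RCLike.norm_conj, norm_neg]
  const_mul := by
    intro c f hf
    refine ⟨hf.1.const_mul c, (hf.2.const_mul ‖c‖).congr (.of_forall fun ξ => ?_)⟩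
    simp only [fourier_const_mul, norm_mul]
    ring

theorem exists_contDiff_ae_eq_of_wienerClass {f : ℂ → ℂ} (hf : ∀ s, WienerClass s f) :
    ∃ φ : ℂ → ℂ, ContDiff ℝ (⊤ : ℕ∞) φ ∧ f =ᵐ[volume] φ := by
  refine ⟨𝓕⁻ (𝓕 f), ?_, ae_eq_fourierInv_fourier (hf 0).1.integrable (hf 0).integrable_fourier⟩
  have h1 : ContDiff ℝ (⊤ : ℕ∞) (𝓕 (𝓕 f)) := by
    refine Real.contDiff_fourier fun n _ => (hf n).2.mono ?_ (.of_forall fun ξ => ?_)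
    · have := continuous_fourier (hf 0).1.integrable
      fun_prop
    · rw [Real.norm_of_nonneg (by positivity), Real.norm_of_nonneg (by positivity)]
      gcongr
      linarith
  have h2 : 𝓕⁻ (𝓕 f) = fun x => 𝓕 (𝓕 f) (-x) := by
    ext x
    exact Real.fourierInv_eq_fourier_neg _ _
  rw [h2]
  exact h1.comp contDiff_neg

/-- Functions that are smooth on all balls, up to null sets, are smooth up to a null set. -/
theorem exists_contDiff_ae_eq_of_forall_ball {u : ℂ → ℂ}
    (h : ∀ n : ℕ, ∃ φ : ℂ → ℂ, ContDiff ℝ (⊤ : ℕ∞) φ ∧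
      ∀ᵐ z, z ∈ Metric.ball (0 : ℂ) n → u z = φ z) :
    ∃ φ : ℂ → ℂ, ContDiff ℝ (⊤ : ℕ∞) φ ∧ u =ᵐ[volume] φ := by
  choose Φ hΦ hu using h
  have hle : ∀ m n, m ≤ n → Set.EqOn (Φ m) (Φ n) (Metric.ball (0 : ℂ) m) := by
    intro m n hmn
    refine Measure.eqOn_open_of_ae_eq (μ := volume) ?_ Metric.isOpen_ball
      (hΦ m).continuous.continuousOn (hΦ n).continuous.continuousOn
    refine (ae_restrict_iff' measurableSet_ball).2 ?_
    filter_upwards [hu m, hu n] with z h1 h2 hz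
    rw [← h1 hz, h2 (Metric.ball_subset_ball (by exact_mod_cast hmn) hz)]
  -- The `+ 1` puts `z` in the open ball of radius `N z`, so a whole neighbourhood of `z` sees the
  -- single smooth function `Φ (N z)`.
  let N : ℂ → ℕ := fun z => ⌊‖z‖⌋₊ + 1
  have hN : ∀ z, z ∈ Metric.ball (0 : ℂ) (N z) := fun z => by
    simpa [N] using Nat.lt_floor_add_one ‖z‖
  have heq : ∀ n : ℕ, ∀ z ∈ Metric.ball (0 : ℂ) n, Φ (N z) z = Φ n z := by
    intro n z hz
    rcases le_total (N z) n with hle' | hle'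
    · exact hle _ _ hle' (hN z)
    · exact (hle _ _ hle' hz).symm
  refine ⟨fun z => Φ (N z) z, contDiff_iff_contDiffAt.2 fun z => ?_, ?_⟩
  · refine (hΦ (N z)).contDiffAt.congr_of_eventuallyEq ?_
    filter_upwards [Metric.isOpen_ball.mem_nhds (hN z)] with w hw using heq _ _ hw
  · filter_upwards [ae_all_iff.2 hu] with z hz using hz _ (hN z)

/-- Solutions in `L⁴` of the cubic first order system are smooth. -/
theorem exists_contDiff_ae_eq_of_weakDbar_cubicRhs {α β : Fin 2 → ℂ} {v : Fin 2 → ℂ → ℂ}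
    (hα : ∀ j, ‖α j‖ₑ ≤ 1) (hv : ∀ j, Measurable (v j)) (h4 : ∫⁻ z, pairNorm v z ^ 4 < ∞)
    (hsol : ∀ j, WeakDbar (v j) (cubicRhs α β v j)) (j : Fin 2) :
    ∃ φ : ℂ → ℂ, ContDiff ℝ (⊤ : ℕ∞) φ ∧ v j =ᵐ[volume] φ := by
  have hloc : ∀ η : ℂ → ℂ, ContDiff ℝ (⊤ : ℕ∞) η → ∀ j,
      WeakDbar (fun z => η z * v j z) (fun z => η z * cubicRhs α β v j z + dbar η z * v j z) :=
    fun η hη j => (hsol j).mul_left (locallyIntegrable_component hv h4 j) hη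
      (locallyIntegrable_cubicRhs hα hv h4 j)
  -- Each regularity statement is made for all cutoffs at once, because the right-hand side
  -- localised by `η` involves other cutoffs: a larger one, `conj η` and `dbar η`.
  have hB : ∀ η : ℂ → ℂ, ContDiff ℝ (⊤ : ℕ∞) η → HasCompactSupport η → ∀ j,
      BddCompact fun z => η z * v j z := fun η hη hc j =>
    ⟨hη.continuous.measurable.mul (hv j), hc.mul_right,
      exists_ae_norm_cutoff_mul_le hα hv h4 hsol hη hc j⟩
  have hL : ∀ η : ℂ → ℂ, ContDiff ℝ (⊤ : ℕ∞) η → HasCompactSupport η → ∀ j,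
      LipschitzL2 fun z => η z * v j z := fun η hη hc j =>
    (hloc η hη j).lipschitzL2 (hB η hη hc j) (conjAlgebra_bddCompact.localized_rhs hB hη hc j)
  have hW : ∀ (s : ℕ) (η : ℂ → ℂ), ContDiff ℝ (⊤ : ℕ∞) η → HasCompactSupport η → ∀ j,
      WienerClass s fun z => η z * v j z := by
    intro s
    induction s with
    | zero =>
      exact fun η hη hc j => (hloc η hη j).wienerClass_zero (hB η hη hc j)
        (conjAlgebra_lipschitzL2.localized_rhs hL hη hc j)
    | succ s ih =>
      exact fun η hη hc j => (hloc η hη j).wienerClass_succ (ih η hη hc j)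
        ((conjAlgebra_wienerClass s).localized_rhs ih hη hc j)
  refine exists_contDiff_ae_eq_of_forall_ball fun n => ?_
  obtain ⟨η, hη, hc, U, -, hKU, h1⟩ := exists_smooth_cutoff (isCompact_closedBall (0 : ℂ) n)
  obtain ⟨φ, hφ, he⟩ := exists_contDiff_ae_eq_of_wienerClass fun s => hW s η hη hc j
  refine ⟨φ, hφ, ?_⟩
  filter_upwards [he] with z hz hzn
  rw [← hz, h1 z (hKU (Metric.ball_subset_closedBall hzn)), one_mul]

/-! ### From the Dirac equation on the plane to the `dbar` system on `ℂ`. -/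

/-- The standard isometry from the complex numbers to the plane. -/
noncomputable def complexToPlane : ℂ ≃ₗᵢ[ℝ] Plane := Complex.orthonormalBasisOneI.repr

theorem complexToPlane_symm_single_zero :
    complexToPlane.symm (EuclideanSpace.single 0 1) = 1 := by
  rw [complexToPlane, OrthonormalBasis.repr_symm_single, Complex.coe_orthonormalBasisOneI]
  rfl

theorem complexToPlane_symm_single_one :
    complexToPlane.symm (EuclideanSpace.single 1 1) = Complex.I := by
  rw [complexToPlane, OrthonormalBasis.repr_symm_single, Complex.coe_orthonormalBasisOneI]
  rfl

theorem integral_comp_complexToPlane (F : Plane → ℂ) :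
    ∫ x, F x = ∫ z, F (complexToPlane z) :=
  (complexToPlane.measurePreserving.integral_comp
    complexToPlane.toHomeomorph.measurableEmbedding F).symm

/-- The spinor field on the plane with the given components, as functions of `x₁ + i x₂`. -/
noncomputable def spinorOf (f g : ℂ → ℂ) (x : Plane) : Spinor :=
  !₂[f (complexToPlane.symm x), g (complexToPlane.symm x)]

theorem contDiff_spinorOf {f g : ℂ → ℂ} (hf : ContDiff ℝ (⊤ : ℕ∞) f)
    (hg : ContDiff ℝ (⊤ : ℕ∞) g) : ContDiff ℝ (⊤ : ℕ∞) (spinorOf f g) := by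
  have he : ContDiff ℝ (⊤ : ℕ∞) complexToPlane.symm := complexToPlane.symm.contDiff
  refine (contDiff_piLp 2).2 fun i => ?_
  fin_cases i
  · exact hf.comp he
  · exact hg.comp he

theorem hasCompactSupport_spinorOf {f g : ℂ → ℂ} (hf : HasCompactSupport f)
    (hg : HasCompactSupport g) : HasCompactSupport (spinorOf f g) := by
  have hf' := hf.comp_homeomorph complexToPlane.symm.toHomeomorph
  have hg' := hg.comp_homeomorph complexToPlane.symm.toHomeomorph
  refine HasCompactSupport.of_support_subset_isCompact (hf'.isCompact.union hg'.isCompact) ?_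
  intro x hx
  by_contra h
  rw [Set.mem_union, not_or] at h
  have h1 : f (complexToPlane.symm x) = 0 := image_eq_zero_of_notMem_tsupport (f := f ∘ _) h.1
  have h2 : g (complexToPlane.symm x) = 0 := image_eq_zero_of_notMem_tsupport (f := g ∘ _) h.2
  refine hx ?_
  ext i
  fin_cases i
  · exact h1
  · exact h2

theorem fderiv_spinorOf {f g : ℂ → ℂ} (hf : Differentiable ℝ f) (hg : Differentiable ℝ g)
    (z : ℂ) (y : Plane) : fderiv ℝ (spinorOf f g) (complexToPlane z) y =
      !₂[fderiv ℝ f z (complexToPlane.symm y), fderiv ℝ g z (complexToPlane.symm y)] := by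
  have he : HasFDerivAt complexToPlane.symm
      (complexToPlane.symm.toContinuousLinearEquiv : Plane →L[ℝ] ℂ) (complexToPlane z) :=
    complexToPlane.symm.toContinuousLinearEquiv.hasFDerivAt
  have hz : complexToPlane.symm (complexToPlane z) = z := complexToPlane.symm_apply_apply z
  have h0 : HasFDerivAt (fun x => f (complexToPlane.symm x)) _ (complexToPlane z) :=
    HasFDerivAt.comp (g := f) (g' := fderiv ℝ f z) _ (by rw [hz]; exact (hf z).hasFDerivAt) he
  have h1 : HasFDerivAt (fun x => g (complexToPlane.symm x)) _ (complexToPlane z) :=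
    HasFDerivAt.comp (g := g) (g' := fderiv ℝ g z) _ (by rw [hz]; exact (hg z).hasFDerivAt) he
  have hd : DifferentiableAt ℝ (spinorOf f g) (complexToPlane z) := by
    refine (differentiableAt_piLp 2).2 fun i => ?_
    fin_cases i
    · exact h0.differentiableAt
    · exact h1.differentiableAt
  have hc : ∀ i, HasFDerivAt (fun x => spinorOf f g x i)
      ((PiLp.proj (𝕜 := ℝ) 2 (fun _ : Fin 2 => ℂ) i).comp (fderiv ℝ (spinorOf f g)
        (complexToPlane z))) (complexToPlane z) := fun i =>
    (PiLp.proj (𝕜 := ℝ) 2 (fun _ : Fin 2 => ℂ) i).hasFDerivAt.comp _ hd.hasFDerivAt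
  ext i
  fin_cases i
  · exact DFunLike.congr_fun ((hc 0).unique h0) y
  · exact DFunLike.congr_fun ((hc 1).unique h1) y

theorem massiveDiracOp_spinorOf (m ω : ℝ) {f g : ℂ → ℂ} (hf : Differentiable ℝ f)
    (hg : Differentiable ℝ g) (z : ℂ) :
    massiveDiracOp m ω (spinorOf f g) (complexToPlane z) =
      !₂[-Complex.I * (fderiv ℝ g z 1 - Complex.I * fderiv ℝ g z Complex.I) + (m - ω) * f z,
        -Complex.I * dbar f z - (m + ω) * g z] := by
  have hz : complexToPlane.symm (complexToPlane z) = z := complexToPlane.symm_apply_apply z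
  ext i
  fin_cases i
  · simp [massiveDiracOp, diracOp, partialDeriv, fderiv_spinorOf hf hg,
      complexToPlane_symm_single_zero, complexToPlane_symm_single_one, pauli1, pauli2, pauli3,
      Matrix.toLpLin_apply, spinorOf, hz]
    ring
  · simp [massiveDiracOp, diracOp, partialDeriv, fderiv_spinorOf hf hg,
      complexToPlane_symm_single_zero, complexToPlane_symm_single_one, pauli1, pauli2, pauli3,
      Matrix.toLpLin_apply, spinorOf, hz, dbar]
    ring

theorem inner_spinor (a : Spinor) (b : Spinor) :
    inner ℂ a b = b 0 * conj (a 0) + b 1 * conj (a 1) := by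
  simp [PiLp.inner_apply]

theorem fderiv_conj {φ : ℂ → ℂ} (hφ : Differentiable ℝ φ) (z h : ℂ) :
    fderiv ℝ (fun w => conj (φ w)) z h = conj (fderiv ℝ φ z h) :=
  DFunLike.congr_fun (Complex.conjCLE.toContinuousLinearMap.hasFDerivAt.comp z
    (hφ z).hasFDerivAt).fderiv h

/-- The components of a spinor field, the second one conjugated, as functions of `x₁ + i x₂`. -/
noncomputable def planarPair (ψ : Plane → Spinor) : Fin 2 → ℂ → ℂ :=
  ![fun z => ψ (complexToPlane z) 0, fun z => conj (ψ (complexToPlane z) 1)]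

theorem norm_sq_spinor (ψ : Plane → Spinor) (z : ℂ) :
    ((‖ψ (complexToPlane z)‖ ^ 2 : ℝ) : ℂ) = planarPair ψ 0 z * conj (planarPair ψ 0 z) +
      planarPair ψ 1 z * conj (planarPair ψ 1 z) := by
  rw [EuclideanSpace.norm_sq_eq, Fin.sum_univ_two]
  simp only [planarPair, Matrix.cons_val_zero, Matrix.cons_val_one, Complex.conj_conj]
  push_cast
  rw [← Complex.mul_conj', ← Complex.conj_mul']

theorem measurable_planarPair {ψ : Plane → Spinor} (hψ : Measurable ψ) (j : Fin 2) :
    Measurable (planarPair ψ j) := by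
  have he : Measurable complexToPlane := complexToPlane.continuous.measurable
  have h : ∀ i : Fin 2, Measurable fun z => ψ (complexToPlane z) i := fun i =>
    (EuclideanSpace.proj (𝕜 := ℂ) i).continuous.measurable.comp (hψ.comp he)
  fin_cases j
  · exact h 0
  · exact Complex.continuous_conj.measurable.comp (h 1)

theorem lintegral_pairNorm_planarPair_lt_top {ψ : Plane → Spinor} (hψ : MemLp ψ 4) :
    ∫⁻ z, pairNorm (planarPair ψ) z ^ 4 < ∞ := by
  have h1 : ∀ z, pairNorm (planarPair ψ) z ≤ 2 * ‖ψ (complexToPlane z)‖ₑ := by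
    intro z
    have h2 : ∀ i, ‖ψ (complexToPlane z) i‖ₑ ≤ ‖ψ (complexToPlane z)‖ₑ := fun i => by
      rw [← ofReal_norm, ← ofReal_norm]
      exact ENNReal.ofReal_le_ofReal (PiLp.norm_apply_le _ i)
    rw [two_mul]
    refine add_le_add (h2 0) ?_
    have h3 : ‖conj (ψ (complexToPlane z) 1)‖ₑ = ‖ψ (complexToPlane z) 1‖ₑ := by
      rw [← ofReal_norm, RCLike.norm_conj, ofReal_norm]
    exact h3.le.trans (h2 1)
  have h3 := (eLpNorm_lt_top_iff_lintegral_rpow_enorm_lt_top (by simp) (by simp)).1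
    (hψ.comp_measurePreserving complexToPlane.measurePreserving).2
  simp only [ENNReal.toReal_ofNat, ENNReal.rpow_ofNat, Function.comp] at h3
  calc _ ≤ ∫⁻ z, 2 ^ 4 * ‖ψ (complexToPlane z)‖ₑ ^ 4 := by
        refine lintegral_mono fun z => ?_
        rw [← mul_pow]
        exact pow_le_pow_left' (h1 z) 4
    _ < ∞ := by
        rw [lintegral_const_mul' _ _ (by simp)]
        exact ENNReal.mul_lt_top (by simp) h3

theorem planarPair_zero (ψ : Plane → Spinor) (z : ℂ) :
    planarPair ψ 0 z = ψ (complexToPlane z) 0 := rfl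

theorem planarPair_one (ψ : Plane → Spinor) (z : ℂ) :
    planarPair ψ 1 z = conj (ψ (complexToPlane z) 1) := rfl

theorem planarPair_one_add_one (ψ : Plane → Spinor) (z : ℂ) :
    planarPair ψ (1 + 1) z = ψ (complexToPlane z) 0 := rfl

theorem spinorOf_complexToPlane (f g : ℂ → ℂ) (z : ℂ) :
    spinorOf f g (complexToPlane z) = !₂[f z, g z] := by
  rw [spinorOf, LinearIsometryEquiv.symm_apply_apply]

/-- The test function enters conjugated because the inner product is conjugate-linear in that slot.
The last summand is the integrand on the other side of the Dirac equation; it cancels there and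
leaves `I` times the weak `dbar` equation for the first component. -/
theorem inner_massiveDiracOp_spinorOf_zero_left (m ω : ℝ) {φ : ℂ → ℂ} (hφ : Differentiable ℝ φ)
    (ψ : Plane → Spinor) (z : ℂ) :
    inner ℂ (massiveDiracOp m ω (spinorOf (fun _ => 0) fun w => conj (φ w)) (complexToPlane z))
        (ψ (complexToPlane z)) =
      Complex.I * (planarPair ψ 0 z * dbar φ z + cubicRhs ![Complex.I, -Complex.I]
        ![m + ω, -m + ω] (planarPair ψ) 0 z * φ z) + cubicRhs 1 0 (planarPair ψ) 0 z * φ z := by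
  have hdc : Differentiable ℝ fun w => conj (φ w) := fun w =>
    (Complex.conjCLE.toContinuousLinearMap.hasFDerivAt.comp w (hφ w).hasFDerivAt).differentiableAt
  rw [massiveDiracOp_spinorOf m ω (differentiable_const _) hdc, inner_spinor]
  simp only [fderiv_conj hφ, cubicRhs, dbar, planarPair_zero, planarPair_one, zero_add,
    Matrix.cons_val_zero, Matrix.cons_val_one, Pi.one_apply, Pi.zero_apply, fderiv_fun_const,
    zero_apply, map_mul, map_add, map_sub, map_neg, map_zero, Complex.conj_conj,
    Complex.conj_I, Complex.conj_ofReal]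
  set a := ψ (complexToPlane z) 0
  set b := ψ (complexToPlane z) 1
  linear_combination -(a * conj a + conj b * b + m + ω) * b * φ z * Complex.I_sq

theorem inner_spinorOf_zero_left (φ : ℂ → ℂ) (ψ : Plane → Spinor) (z : ℂ) :
    inner ℂ (spinorOf (fun _ => 0) (fun w => conj (φ w)) (complexToPlane z))
        ((‖ψ (complexToPlane z)‖ ^ 2) • ψ (complexToPlane z)) =
      cubicRhs 1 0 (planarPair ψ) 0 z * φ z := by
  rw [inner_spinor, spinorOf_complexToPlane]
  simp only [PiLp.smul_apply, Complex.real_smul, norm_sq_spinor, cubicRhs, planarPair_zero,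
    planarPair_one, zero_add, Matrix.cons_val_zero, Matrix.cons_val_one, Pi.one_apply,
    Pi.zero_apply, map_zero, Complex.conj_conj]
  ring

/-- Here the whole pairing is conjugated, so that `conj ψ₂` and `φ` appear unconjugated. The last
summand again cancels, leaving `-I` times the weak equation for the second component of the pair. -/
theorem conj_inner_massiveDiracOp_spinorOf_zero_right (m ω : ℝ) {φ : ℂ → ℂ}
    (hφ : Differentiable ℝ φ) (ψ : Plane → Spinor) (z : ℂ) :
    conj (inner ℂ (massiveDiracOp m ω (spinorOf φ fun _ => 0) (complexToPlane z))
        (ψ (complexToPlane z))) =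
      -Complex.I * (planarPair ψ 1 z * dbar φ z + cubicRhs ![Complex.I, -Complex.I]
        ![m + ω, -m + ω] (planarPair ψ) 1 z * φ z) + cubicRhs 1 0 (planarPair ψ) 1 z * φ z := by
  rw [massiveDiracOp_spinorOf m ω hφ (differentiable_const _), inner_spinor]
  simp only [cubicRhs, planarPair_zero, planarPair_one, planarPair_one_add_one,
    Matrix.cons_val_zero, Matrix.cons_val_one, Pi.one_apply, Pi.zero_apply, fderiv_fun_const,
    zero_apply, map_mul, map_add, map_sub, map_neg, map_zero, Complex.conj_conj,
    Complex.conj_I, Complex.conj_ofReal]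
  set a := ψ (complexToPlane z) 0
  set b := ψ (complexToPlane z) 1
  linear_combination -(a * conj a + conj b * b - m + ω) * conj a * φ z * Complex.I_sq

theorem conj_inner_spinorOf_zero_right (φ : ℂ → ℂ) (ψ : Plane → Spinor) (z : ℂ) :
    conj (inner ℂ (spinorOf φ (fun _ => 0) (complexToPlane z))
        ((‖ψ (complexToPlane z)‖ ^ 2) • ψ (complexToPlane z))) =
      cubicRhs 1 0 (planarPair ψ) 1 z * φ z := by
  rw [inner_spinor, spinorOf_complexToPlane]
  simp only [PiLp.smul_apply, Complex.real_smul, norm_sq_spinor, cubicRhs, planarPair_zero,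
    planarPair_one, planarPair_one_add_one, Matrix.cons_val_zero, Matrix.cons_val_one,
    Pi.one_apply, Pi.zero_apply, map_mul, map_add, map_zero, Complex.conj_conj]
  ring

/-- The first order system satisfied by the components of a solution. -/
theorem IsDistributionalSolution.weakDbar_planarPair {m ω : ℝ} {ψ : Plane → Spinor}
    (hsol : IsDistributionalSolution m ω ψ) (hm : Measurable ψ) (hψ : MemLp ψ 4) (j : Fin 2) :
    WeakDbar (planarPair ψ j)
      (cubicRhs ![Complex.I, -Complex.I] ![m + ω, -m + ω] (planarPair ψ) j) := by
  intro φ hφ hc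
  have hd : Differentiable ℝ φ := hφ.differentiable (by simp)
  have hv := measurable_planarPair hm
  have h4 := lintegral_pairNorm_planarPair_lt_top hψ
  set v := planarPair ψ
  have i1 : Integrable fun z => v j z * dbar φ z := by
    have := (locallyIntegrable_component hv h4 j).integrable_smul_left_of_hasCompactSupport
      (contDiff_dbar hφ).continuous (hasCompactSupport_dbar hc)
    simpa only [smul_eq_mul, mul_comm] using this
  have i2 : ∀ α β : Fin 2 → ℂ, (∀ j, ‖α j‖ₑ ≤ 1) → Integrable fun z => cubicRhs α β v j z * φ z := by
    intro α β hα
    have := (locallyIntegrable_cubicRhs (β := β) hα hv h4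
      j).integrable_smul_left_of_hasCompactSupport hφ.continuous hc
    simpa only [smul_eq_mul, mul_comm] using this
  have i3 := i2 ![Complex.I, -Complex.I] ![m + ω, -m + ω] fun k => by
    rw [← ofReal_norm]
    fin_cases k <;> simp
  have i4 := i2 1 0 fun k => by simp
  let T : ℂ → ℂ := fun z => v j z * dbar φ z +
    cubicRhs ![Complex.I, -Complex.I] ![m + ω, -m + ω] v j z * φ z
  let N : ℂ → ℂ := fun z => cubicRhs 1 0 v j z * φ z
  suffices h : ∫ z, T z = 0 by
    rw [integral_add i1 i3] at h
    exact eq_neg_of_add_eq_zero_left h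
  have hT : Integrable T := i1.add i3
  have hzero : ∀ c : ℂ, c ≠ 0 → ∫ z, (c * T z + N z) = ∫ z, N z → ∫ z, T z = 0 := by
    intro c hc0 h
    rw [integral_add (hT.const_mul c) i4, integral_const_mul, add_eq_right, mul_eq_zero] at h
    exact h.resolve_left hc0
  obtain rfl | rfl : j = 0 ∨ j = 1 := by fin_cases j <;> simp
  · have H := hsol (spinorOf (fun _ => 0) fun w => conj (φ w))
      (contDiff_spinorOf contDiff_const (Complex.conjCLE.contDiff.comp hφ))
      (hasCompactSupport_spinorOf HasCompactSupport.zero (hc.comp_left (map_zero _)))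
    rw [integral_comp_complexToPlane, integral_comp_complexToPlane] at H
    simp only [inner_massiveDiracOp_spinorOf_zero_left m ω hd, inner_spinorOf_zero_left] at H
    exact hzero Complex.I Complex.I_ne_zero H
  · have H := hsol (spinorOf φ fun _ => 0)
      (contDiff_spinorOf hφ contDiff_const) (hasCompactSupport_spinorOf hc HasCompactSupport.zero)
    rw [integral_comp_complexToPlane, integral_comp_complexToPlane] at H
    replace H := congrArg conj H
    rw [← integral_conj, ← integral_conj] at H
    simp only [conj_inner_massiveDiracOp_spinorOf_zero_right m ω hd,
      conj_inner_spinorOf_zero_right] at H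
    exact hzero (-Complex.I) (neg_ne_zero.2 Complex.I_ne_zero) H

/-- Every distributional solution in `L⁴` of the critical massive Dirac equation agrees almost
everywhere with a smooth spinor field. -/
theorem proposition5p6 (m ω : ℝ) (hm : 0 < m) (hω : ω ∈ Set.Ioo (-m) m)
    (ψ : Plane → Spinor) (hψ : MemLp ψ 4 volume)
    (hsol : IsDistributionalSolution m ω ψ) :
    ∃ φ : Plane → Spinor, ContDiff ℝ (⊤ : ℕ∞) φ ∧ ψ =ᵐ[volume] φ := by
  -- The regularity results ask for honest measurability, so `ψ` is replaced by a measurable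
  -- representative; both sides of the weak equation depend only on its class.
  set ψ' := hψ.1.mk ψ with hψ'
  have hae : ψ =ᵐ[volume] ψ' := hψ.1.ae_eq_mk
  have hmeas : Measurable ψ' := hψ.1.stronglyMeasurable_mk.measurable
  have hmem : MemLp ψ' 4 volume := (memLp_congr_ae hae).1 hψ
  have hsol' : IsDistributionalSolution m ω ψ' := by
    intro χ hχ hc
    have h := hsol χ hχ hc
    rwa [integral_congr_ae (hae.mono fun x hx => by
        simp only [hx] : (fun x => inner ℂ (massiveDiracOp m ω χ x) (ψ x)) =ᵐ[volume]
          fun x => inner ℂ (massiveDiracOp m ω χ x) (ψ' x)),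
      integral_congr_ae (hae.mono fun x hx => by
        simp only [hx] : (fun x => inner ℂ (χ x) ((‖ψ x‖ ^ 2) • ψ x)) =ᵐ[volume]
          fun x => inner ℂ (χ x) ((‖ψ' x‖ ^ 2) • ψ' x))] at h
  have hreg := exists_contDiff_ae_eq_of_weakDbar_cubicRhs (fun k => by
    rw [← ofReal_norm]
    fin_cases k <;> simp) (measurable_planarPair hmeas)
    (lintegral_pairNorm_planarPair_lt_top hmem) (hsol'.weakDbar_planarPair hmeas hmem)
  obtain ⟨φ₀, hφ₀, h0⟩ := hreg 0
  obtain ⟨φ₁, hφ₁, h1⟩ := hreg 1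
  refine ⟨spinorOf φ₀ fun z => conj (φ₁ z),
    contDiff_spinorOf hφ₀ (Complex.conjCLE.contDiff.comp hφ₁), ?_⟩
  have hq := complexToPlane.symm.measurePreserving.quasiMeasurePreserving
  filter_upwards [hae, hq.ae h0, hq.ae h1] with x hx hx0 hx1
  rw [hx]
  simp only [planarPair, Matrix.cons_val_zero, Matrix.cons_val_one,
    LinearIsometryEquiv.apply_symm_apply] at hx0 hx1
  ext i
  fin_cases i
  · exact hx0
  · change ψ' x 1 = conj (φ₁ (complexToPlane.symm x))
    rw [← hx1, Complex.conj_conj]
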